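/- Let $(M,g_M,J)$ be an almost Hermitian manifold ($J$ a smooth field of endomorphisms of $TM$ with $J^2=-\mathrm{id}$ and $g_M(JX,JY)=g_M(X,Y)$), let $(N,g_N)$ be a Riemannian manifold, and let $F:M\to N$ be a Riemannian submersion of $M$ onto $N$ (a surjective $C^\infty$ submersion whose differential $F_*$ preserves the lengths of horizontal vectors, i.e. of the vectors in $(\ker F_*)^\perp$). Suppose that $F$ is a v-semi-slant submersion with complex distribution $\mathcal D_1$ and v-semi-slant angle $\theta$: $\mathcal D_1\subset(\ker F_*)^\perp$ is a smooth distribution with $J(\mathcal D_1)=\mathcal D_1$ and, $\mathcal D_2$ denoting the orthogonal complement of $\mathcal D_1$ in $(\ker F_*)^\perp$, for every $p\in M$ and every nonzero $X\in(\mathcal D_2)_p$ the angle between $JX$ and the space $(\mathcal D_2)_p$ is equal to $\theta$. Assume $\theta\neq 0$ (no restriction if $\mathcal D_2=0$, when any number may serve as $\theta$). Let $\mathcal V$ and $\mathcal H$ be the orthogonal projections of $TM$ onto $\ker F_*$ and $(\ker F_*)^\perp$, let $\nabla$ be the Levi-Civita connection of $g_M$, put $$\mathcal A_XY=\mathcal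 H\nabla_{\mathcal HX}\mathcal VY+\mathcal V\nabla_{\mathcal HX}\mathcal HY$$ for vector fields $X,Y$ on $M$, and $BZ=\mathcal V(JZ)$ for horizontal $Z$, extended to all of $TM$ by $BZ=\mathcal V(J\mathcal HZ)$. **Theorem 3.5.** The distribution $\mathcal D_1$ is integrable (through every point of $M$ there passes an integral manifold of $\mathcal D_1$) if and only if $$\mathcal A_XY=0\quad\text{and}\quad B(\nabla_XY-\nabla_YX)=0\qquad\text{for all } X,Y\in\Gamma(\mathcal D_1).$$ -/

import Mathlib

open Set Manifold Bundle
open scoped ContDiff Topology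

set_option linter.unusedSectionVars false

noncomputable section

namespace VSemiSlant

section OneManifold

variable {E : Type*} [NormedAddCommGroup E] [NormedSpace ℝ E] [FiniteDimensional ℝ E]
  {M : Type*} [TopologicalSpace M] [ChartedSpace E M]

instance instFiniteDimensionalTangentSpace (x : M) :
    FiniteDimensional ℝ (TangentSpace 𝓘(ℝ, E) x) :=
  inferInstanceAs (FiniteDimensional ℝ E)

/-- A `C^∞` vector field on `M`. -/
def IsSmoothField [IsManifold 𝓘(ℝ, E) ∞ M] (X : Π x : M, TangentSpace 𝓘(ℝ, E) x) : Prop :=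
  ContMDiff 𝓘(ℝ, E) 𝓘(ℝ, E).tangent ∞ (fun x ↦ (⟨x, X x⟩ : TangentBundle 𝓘(ℝ, E) M))

/-- `D` is a smooth distribution (a smooth subbundle of the tangent bundle): near every point it
is spanned by a smooth local frame. In particular its rank is locally constant. -/
def IsSmoothDistribution [IsManifold 𝓘(ℝ, E) ∞ M]
    (D : Π x : M, Submodule ℝ (TangentSpace 𝓘(ℝ, E) x)) : Prop :=
  ∀ p : M, ∃ (k : ℕ) (U : Set M) (s : Fin k → Π x : M, TangentSpace 𝓘(ℝ, E) x),
    IsOpen U ∧ p ∈ U ∧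
    (∀ i, ContMDiffOn 𝓘(ℝ, E) 𝓘(ℝ, E).tangent ∞
      (fun x ↦ (⟨x, s i x⟩ : TangentBundle 𝓘(ℝ, E) M)) U) ∧
    ∀ x ∈ U, LinearIndependent ℝ (fun i ↦ s i x) ∧
      Submodule.span ℝ (range fun i ↦ s i x) = D x

/-- `X ∈ Γ(D)`: a smooth vector field with values in `D`. -/
def IsSectionOf [IsManifold 𝓘(ℝ, E) ∞ M]
    (D : Π x : M, Submodule ℝ (TangentSpace 𝓘(ℝ, E) x))
    (X : Π x : M, TangentSpace 𝓘(ℝ, E) x) : Prop :=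
  IsSmoothField X ∧ ∀ x, X x ∈ D x

/-- `D` is integrable: through every point of `M` there passes an integral manifold of `D`,
that is, an injectively immersed submanifold whose tangent space at each of its points is
the fibre of `D`. (As the condition is local, the submanifold may be taken parametrized by an
open subset `U` of some `ℝ^k`.) -/
def IsIntegrable (D : Π x : M, Submodule ℝ (TangentSpace 𝓘(ℝ, E) x)) : Prop :=
  ∀ p : M, ∃ (k : ℕ) (U : Set (EuclideanSpace ℝ (Fin k))) (φ : EuclideanSpace ℝ (Fin k) → M),
    IsOpen U ∧ p ∈ φ '' U ∧ InjOn φ U ∧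
    ContMDiffOn 𝓘(ℝ, EuclideanSpace ℝ (Fin k)) 𝓘(ℝ, E) ∞ φ U ∧
    ∀ u ∈ U,
      Function.Injective (mfderiv 𝓘(ℝ, EuclideanSpace ℝ (Fin k)) 𝓘(ℝ, E) φ u) ∧
      (mfderiv 𝓘(ℝ, EuclideanSpace ℝ (Fin k)) 𝓘(ℝ, E) φ u).range = D (φ u)

variable [RiemannianBundle (fun x : M ↦ TangentSpace 𝓘(ℝ, E) x)]

/-- `J` is an almost complex structure compatible with the metric, so that `(M, g, J)` is
an almost Hermitian manifold: a smooth field of endomorphisms with `J² = -id` and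
`g(JX, JY) = g(X, Y)`. -/
structure IsAlmostHermitian [IsManifold 𝓘(ℝ, E) ∞ M]
    (J : Π x : M, TangentSpace 𝓘(ℝ, E) x →L[ℝ] TangentSpace 𝓘(ℝ, E) x) : Prop where
  contMDiff : ContMDiff 𝓘(ℝ, E) (𝓘(ℝ, E).prod 𝓘(ℝ, E →L[ℝ] E)) ∞
    (fun x ↦ TotalSpace.mk' (E →L[ℝ] E)
      (E := fun x : M ↦ TangentSpace 𝓘(ℝ, E) x →L[ℝ] TangentSpace 𝓘(ℝ, E) x) x (J x))
  sq_eq_neg : ∀ (x : M) (v : TangentSpace 𝓘(ℝ, E) x), J x (J x v) = -v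
  inner_map_map : ∀ (x : M) (v w : TangentSpace 𝓘(ℝ, E) x),
    inner ℝ (J x v) (J x w) = inner ℝ v w

/-- The right-hand side of the Koszul formula for `g(∇_X Y, Z)`. -/
def koszul (X Y Z : Π x : M, TangentSpace 𝓘(ℝ, E) x) (x : M) : ℝ :=
  (1 / 2) *
    (mvfderiv 𝓘(ℝ, E) (fun y ↦ inner ℝ (Y y) (Z y)) x (X x)
      + mvfderiv 𝓘(ℝ, E) (fun y ↦ inner ℝ (X y) (Z y)) x (Y x)
      - mvfderiv 𝓘(ℝ, E) (fun y ↦ inner ℝ (X y) (Y y)) x (Z x)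
      + inner ℝ (VectorField.mlieBracket 𝓘(ℝ, E) X Y x) (Z x)
      - inner ℝ (VectorField.mlieBracket 𝓘(ℝ, E) X Z x) (Y x)
      - inner ℝ (VectorField.mlieBracket 𝓘(ℝ, E) Y Z x) (X x))

/-- The Levi-Civita covariant derivative `∇_X Y` of the metric: the vector field determined by the
Koszul formula, written out in an orthonormal basis `(e i)` of each tangent space as
`∑ i, g(∇_X Y, e i) e i`. The Koszul expression is tensorial in its last argument, so
the choice of a vector field extending `e i` does not matter (see `inner_leviCivita`). -/
def leviCivita [IsManifold 𝓘(ℝ, E) ∞ M] (X Y : Π x : M, TangentSpace 𝓘(ℝ, E) x) (x : M) :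
    TangentSpace 𝓘(ℝ, E) x :=
  ∑ i, koszul X Y
      (FiberBundle.extend E (stdOrthonormalBasis ℝ (TangentSpace 𝓘(ℝ, E) x) i)) x •
    stdOrthonormalBasis ℝ (TangentSpace 𝓘(ℝ, E) x) i

theorem mdifferentiableAt_inner [IsManifold 𝓘(ℝ, E) ∞ M]
    [IsContMDiffRiemannianBundle 𝓘(ℝ, E) ∞ E (fun x : M ↦ TangentSpace 𝓘(ℝ, E) x)]
    {X Y : Π x : M, TangentSpace 𝓘(ℝ, E) x} {x : M}
    (hX : MDiffAt (T% X) x) (hY : MDiffAt (T% Y) x) :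
    MDiffAt (fun y ↦ inner ℝ (X y) (Y y)) x :=
  MDifferentiableAt.inner_bundle (IB := 𝓘(ℝ, E)) (F := E)
    (E := fun x : M ↦ TangentSpace 𝓘(ℝ, E) x) (b := fun y : M ↦ y) hX hY

/-- The Koszul expression is tensorial in its last argument. -/
theorem tensorialAt_koszul [IsManifold 𝓘(ℝ, E) ∞ M]
    [IsContMDiffRiemannianBundle 𝓘(ℝ, E) ∞ E (fun x : M ↦ TangentSpace 𝓘(ℝ, E) x)]
    {X Y : Π x : M, TangentSpace 𝓘(ℝ, E) x} {x : M}
    (hX : MDiffAt (T% X) x) (hY : MDiffAt (T% Y) x) :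
    TensorialAt 𝓘(ℝ, E) E (fun Z ↦ koszul X Y Z x) x where
  smul {f Z} hf hZ := by
    have h1 : (fun y ↦ inner ℝ (Y y) ((f • Z) y)) = fun y ↦ f y * inner ℝ (Y y) (Z y) := by
      ext y; simp [inner_smul_right]
    have h2 : (fun y ↦ inner ℝ (X y) ((f • Z) y)) = fun y ↦ f y * inner ℝ (X y) (Z y) := by
      ext y; simp [inner_smul_right]
    simp only [koszul]
    rw [h1, h2, mvfderiv_fun_mul hf (mdifferentiableAt_inner hY hZ), mvfderiv_fun_mul hf (mdifferentiableAt_inner hX hZ),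
      VectorField.mlieBracket_smul_right hf hZ, VectorField.mlieBracket_smul_right hf hZ]
    simp [inner_add_left, inner_smul_left, inner_smul_right]
    rw [real_inner_comm (Y x) (Z x), real_inner_comm (X x) (Z x)]
    ring
  add {Z Z'} hZ hZ' := by
    have h1 : (fun y ↦ inner ℝ (Y y) ((Z + Z') y))
        = fun y ↦ inner ℝ (Y y) (Z y) + inner ℝ (Y y) (Z' y) := by
      ext y; simp [inner_add_right]
    have h2 : (fun y ↦ inner ℝ (X y) ((Z + Z') y))
        = fun y ↦ inner ℝ (X y) (Z y) + inner ℝ (X y) (Z' y) := by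
      ext y; simp [inner_add_right]
    simp only [koszul]
    rw [h1, h2, mvfderiv_fun_add (mdifferentiableAt_inner hY hZ) (mdifferentiableAt_inner hY hZ'),
      mvfderiv_fun_add (mdifferentiableAt_inner hX hZ) (mdifferentiableAt_inner hX hZ'),
      VectorField.mlieBracket_add_right hZ hZ', VectorField.mlieBracket_add_right hZ hZ']
    simp [inner_add_left, inner_add_right]
    ring

/-- The Koszul formula. -/
theorem inner_leviCivita [IsManifold 𝓘(ℝ, E) ∞ M]
    [IsContMDiffRiemannianBundle 𝓘(ℝ, E) ∞ E (fun x : M ↦ TangentSpace 𝓘(ℝ, E) x)]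
    {X Y Z : Π x : M, TangentSpace 𝓘(ℝ, E) x} {x : M}
    (hX : MDiffAt (T% X) x) (hY : MDiffAt (T% Y) x) (hZ : MDiffAt (T% Z) x) :
    inner ℝ (leviCivita X Y x) (Z x) = koszul X Y Z x := by
  have hT := tensorialAt_koszul hX hY
  have h0 : ∀ v, koszul X Y (FiberBundle.extend E v) x
      = TensorialAt.mkHom (fun Z ↦ koszul X Y Z x) x hT v := fun v ↦
    (TensorialAt.mkHom_apply_eq_extend hT v).symm
  rw [← TensorialAt.mkHom_apply hT hZ, leviCivita, sum_inner]
  conv_rhs => rw [← (stdOrthonormalBasis ℝ (TangentSpace 𝓘(ℝ, E) x)).sum_repr' (Z x)]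
  rw [map_sum]
  refine Finset.sum_congr rfl fun i _ ↦ ?_
  rw [h0, inner_smul_left, map_smul, smul_eq_mul]
  simp [mul_comm]

/-- `∇` is compatible with the metric. -/
theorem leviCivita_metric [IsManifold 𝓘(ℝ, E) ∞ M]
    [IsContMDiffRiemannianBundle 𝓘(ℝ, E) ∞ E (fun x : M ↦ TangentSpace 𝓘(ℝ, E) x)]
    {X Y Z : Π x : M, TangentSpace 𝓘(ℝ, E) x} {x : M}
    (hX : MDiffAt (T% X) x) (hY : MDiffAt (T% Y) x) (hZ : MDiffAt (T% Z) x) :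
    mvfderiv 𝓘(ℝ, E) (fun y ↦ inner ℝ (Y y) (Z y)) x (X x)
      = inner ℝ (leviCivita X Y x) (Z x) + inner ℝ (Y x) (leviCivita X Z x) := by
  rw [real_inner_comm (leviCivita X Z x), inner_leviCivita hX hY hZ, inner_leviCivita hX hZ hY]
  simp only [koszul, fun y ↦ real_inner_comm (Y y) (Z y)]
  rw [VectorField.mlieBracket_swap_apply (V := Z) (W := Y), inner_neg_left]
  ring

/-- `∇` is torsion free. -/
theorem leviCivita_sub [IsManifold 𝓘(ℝ, E) ∞ M]
    [IsContMDiffRiemannianBundle 𝓘(ℝ, E) ∞ E (fun x : M ↦ TangentSpace 𝓘(ℝ, E) x)]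
    {X Y : Π x : M, TangentSpace 𝓘(ℝ, E) x} {x : M}
    (hX : MDiffAt (T% X) x) (hY : MDiffAt (T% Y) x) :
    leviCivita X Y x - leviCivita Y X x = VectorField.mlieBracket 𝓘(ℝ, E) X Y x := by
  refine ext_inner_right ℝ fun v ↦ ?_
  have hZ : MDiffAt (T% (FiberBundle.extend E v)) x := FiberBundle.mdifferentiableAt_extend ..
  have hv : FiberBundle.extend E v x = v := by simp
  rw [← hv, inner_sub_left, inner_leviCivita hX hY hZ, inner_leviCivita hY hX hZ]
  simp only [koszul, fun y ↦ real_inner_comm (X y) (Y y)]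
  rw [VectorField.mlieBracket_swap_apply (V := Y) (W := X), inner_neg_left]
  ring

end OneManifold

section Submersion

variable (E : Type*) [NormedAddCommGroup E] [NormedSpace ℝ E] [FiniteDimensional ℝ E]
  (E' : Type*) [NormedAddCommGroup E'] [NormedSpace ℝ E'] [FiniteDimensional ℝ E']
  {M : Type*} [TopologicalSpace M] [ChartedSpace E M]
  [RiemannianBundle (fun x : M ↦ TangentSpace 𝓘(ℝ, E) x)]
  {N : Type*} [TopologicalSpace N] [ChartedSpace E' N]

/-- The vertical space `(ker F_*)_x`. -/
def vertical (F : M → N) (x : M) : Submodule ℝ (TangentSpace 𝓘(ℝ, E) x) :=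
  (mfderiv 𝓘(ℝ, E) 𝓘(ℝ, E') F x).ker

/-- The horizontal space `((ker F_*)^⊥)_x`. -/
def horizontal (F : M → N) (x : M) : Submodule ℝ (TangentSpace 𝓘(ℝ, E) x) :=
  (vertical E E' F x)ᗮ

/-- `𝒱U`, the vertical part of a vector field. -/
def vertPart (F : M → N) (U : Π x : M, TangentSpace 𝓘(ℝ, E) x) (x : M) :
    TangentSpace 𝓘(ℝ, E) x :=
  (vertical E E' F x).starProjection (U x)

/-- `ℋU`, the horizontal part of a vector field. -/
def horPart (F : M → N) (U : Π x : M, TangentSpace 𝓘(ℝ, E) x) (x : M) :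
    TangentSpace 𝓘(ℝ, E) x :=
  (horizontal E E' F x).starProjection (U x)

/-- O'Neill's tensor `𝒜_X Y = ℋ∇_{ℋX} 𝒱Y + 𝒱∇_{ℋX} ℋY`. -/
def tensorA [IsManifold 𝓘(ℝ, E) ∞ M] (F : M → N) (X Y : Π x : M, TangentSpace 𝓘(ℝ, E) x) :
    Π x : M, TangentSpace 𝓘(ℝ, E) x :=
  horPart E E' F (leviCivita (horPart E E' F X) (vertPart E E' F Y)) +
    vertPart E E' F (leviCivita (horPart E E' F X) (horPart E E' F Y))

/-- `BZ = 𝒱JZ` for horizontal `Z` (extended by `0` to vertical fields). -/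
def opB (J : Π x : M, TangentSpace 𝓘(ℝ, E) x →L[ℝ] TangentSpace 𝓘(ℝ, E) x) (F : M → N)
    (Z : Π x : M, TangentSpace 𝓘(ℝ, E) x) : Π x : M, TangentSpace 𝓘(ℝ, E) x :=
  vertPart E E' F (fun x ↦ J x (horPart E E' F Z x))

/-- `F` is a Riemannian submersion of `M` onto `N`. -/
structure IsRiemannianSubmersion [RiemannianBundle (fun y : N ↦ TangentSpace 𝓘(ℝ, E') y)]
    (F : M → N) : Prop where
  contMDiff : ContMDiff 𝓘(ℝ, E) 𝓘(ℝ, E') ∞ F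
  surjective : Function.Surjective F
  surjective_mfderiv : ∀ x, Function.Surjective (mfderiv 𝓘(ℝ, E) 𝓘(ℝ, E') F x)
  norm_mfderiv : ∀ x, ∀ v ∈ horizontal E E' F x, ‖mfderiv 𝓘(ℝ, E) 𝓘(ℝ, E') F x v‖ = ‖v‖

/-- The fibre at `x` of `D₂`, the orthogonal complement of `D₁` in `(ker F_*)^⊥`. -/
def slantPart (F : M → N) (D₁ : Π x : M, Submodule ℝ (TangentSpace 𝓘(ℝ, E) x)) (x : M) :
    Submodule ℝ (TangentSpace 𝓘(ℝ, E) x) :=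
  (D₁ x)ᗮ ⊓ horizontal E E' F x

/-- `F` is a v-semi-slant submersion with complex distribution `D₁` and v-semi-slant angle `θ`.
The angle between a vector `w ≠ 0` and a subspace is the angle between `w` and its orthogonal
projection to the subspace (`π / 2` if the projection vanishes). -/
structure IsVSemiSlantSubmersion [IsManifold 𝓘(ℝ, E) ∞ M]
    [RiemannianBundle (fun y : N ↦ TangentSpace 𝓘(ℝ, E') y)]
    (J : Π x : M, TangentSpace 𝓘(ℝ, E) x →L[ℝ] TangentSpace 𝓘(ℝ, E) x) (F : M → N)
    (D₁ : Π x : M, Submodule ℝ (TangentSpace 𝓘(ℝ, E) x)) (θ : ℝ) : Prop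
    extends IsRiemannianSubmersion E E' F where
  isSmoothDistribution : IsSmoothDistribution D₁
  le_horizontal : ∀ x, D₁ x ≤ horizontal E E' F x
  map_complex : ∀ x, (D₁ x).map (J x : TangentSpace 𝓘(ℝ, E) x →ₗ[ℝ] TangentSpace 𝓘(ℝ, E) x) = D₁ x
  angle_eq : ∀ x, ∀ v ∈ slantPart E E' F D₁ x, v ≠ 0 →
    InnerProductGeometry.angle (J x v) ((slantPart E E' F D₁ x).starProjection (J x v)) = θ

end Submersion

end VSemiSlant

end

/-! By the Frobenius theorem (`isIntegrable_iff_isInvolutive`), integrability of `D₁` means that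
`[X, Y] = ∇_X Y - ∇_Y X` is a section of `D₁` whenever `X` and `Y` are. The two conditions of the
theorem split this membership in two.

The first says that `[X, Y]` is horizontal. For horizontal `X`, `Y` one has `𝒜_X Y = 𝒱∇_X Y`, and
O'Neill's lemma (`koszul_eq`) gives `g(∇_X Y, V) = ½ g([X, Y], V)` for vertical `V`. Indeed every
term of the Koszul formula other than `g([X, Y], V)` is an inner product with a horizontal factor,
so it can be computed with the pulled-back metric of `N`; there these terms cancel because `F_* V =
0`.

The second places a horizontal `Z = [X, Y]` in `D₁`. `BZ = 0` says that `JZ` is horizontal; then the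
`D₂`-component of `Z` is sent by `J` into `D₂`, at angle zero, which `θ ≠ 0` forbids unless that
component vanishes (`mem_of_map_mem_horizontal`). Conversely `J(D₁) = D₁` is horizontal.

For Frobenius, a frame of an involutive distribution is normalised so that it commutes. The integral
manifold is then parametrized by the time-one values of the solutions of `α' = T(α) v`, and
Grönwall's inequality identifies the derivative in `v`. -/

noncomputable section

namespace VSemiSlant

/-! ### Frobenius theorem for commuting frames in a vector space -/

section Calculus

open Metric

variable {A : Type*} [NormedAddCommGroup A] [NormedSpace ℝ A]
  {E : Type*} [NormedAddCommGroup E] [NormedSpace ℝ E]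

/-- Uniform first and second order estimates for a `C²` map near a point. -/
theorem exists_uniform_taylor_bound {T : E → A} {U : Set E} {y₀ : E} (hU : U ∈ 𝓝 y₀)
    (hT : ContDiffAt ℝ 2 T y₀) :
    ∃ R > 0, ∃ C ≥ 1, closedBall y₀ R ⊆ U ∧
      (∀ y ∈ closedBall y₀ R, DifferentiableAt ℝ T y ∧ ‖T y‖ ≤ C ∧ ‖fderiv ℝ T y‖ ≤ C) ∧
      ∀ y ∈ closedBall y₀ R, ∀ z ∈ closedBall y₀ R, ‖T z - T y‖ ≤ C * ‖z - y‖ ∧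
        ‖T z - T y - fderiv ℝ T y (z - y)‖ ≤ C * ‖z - y‖ ^ 2 := by
  have hd : ContDiffAt ℝ 1 (fderiv ℝ T) y₀ := hT.fderiv_right (by norm_num)
  obtain ⟨K, s, hs, hK⟩ := hd.exists_lipschitzOnWith
  have e1 : ∀ᶠ y in 𝓝 y₀, ‖T y‖ < ‖T y₀‖ + 1 :=
    hT.continuousAt.norm.eventually_lt continuousAt_const (by simp)
  have e2 : ∀ᶠ y in 𝓝 y₀, ‖fderiv ℝ T y‖ < ‖fderiv ℝ T y₀‖ + 1 :=
    hd.continuousAt.norm.eventually_lt continuousAt_const (by simp)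
  have e3 : ∀ᶠ y in 𝓝 y₀, DifferentiableAt ℝ T y := by
    filter_upwards [hT.eventually (by simp)] with y hy using hy.differentiableAt (by norm_num)
  obtain ⟨R, hR, hball⟩ := Metric.nhds_basis_closedBall.mem_iff.1
    (((((Filter.eventually_mem_set.2 hU).and (Filter.eventually_mem_set.2 hs)).and e1).and
      e2).and e3 : ∀ᶠ y in 𝓝 y₀, _)
  -- One constant dominating `T`, its derivative and the Lipschitz constant `K` of the derivative.
  set C : ℝ := ‖T y₀‖ + ‖fderiv ℝ T y₀‖ + K + 1 with hC
  have n1 := norm_nonneg (T y₀)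
  have n2 := norm_nonneg (fderiv ℝ T y₀)
  have n3 : (0 : ℝ) ≤ K := K.2
  have hb : ∀ y ∈ closedBall y₀ R, ‖fderiv ℝ T y‖ ≤ C := fun y hy ↦ by
    have := (hball hy).1.2; linarith
  refine ⟨R, hR, C, by linarith, fun y hy ↦ (hball hy).1.1.1.1, fun y hy ↦
    ⟨(hball hy).2, by have := (hball hy).1.1.2; linarith, hb y hy⟩, fun y hy z hz ↦ ⟨?_, ?_⟩⟩
  · exact (convex_closedBall y₀ R).norm_image_sub_le_of_norm_fderiv_le
      (fun x hx ↦ (hball hx).2) hb hy hz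
  · have hsub : segment ℝ y z ⊆ closedBall y₀ R := (convex_closedBall y₀ R).segment_subset hy hz
    -- Mean value inequality for `T` minus its linear part at `y`: on the segment the derivative of
    -- `T` differs from its value at `y` by at most `C * ‖z - y‖`.
    have := (convex_segment y z).norm_image_sub_le_of_norm_fderiv_le' (𝕜 := ℝ)
      (f := T) (C := C * ‖z - y‖) (φ := fderiv ℝ T y)
      (fun x hx ↦ (hball (hsub hx)).2) (fun x hx ↦ ?_)
      (left_mem_segment ℝ y z) (right_mem_segment ℝ y z)
    · rw [pow_two, ← mul_assoc]; exact this
    · have h1 := hK.dist_le_mul x (hball (hsub hx)).1.1.1.2 y (hball hy).1.1.1.2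
      rw [dist_eq_norm, dist_eq_norm] at h1
      refine h1.trans (mul_le_mul (by linarith) ?_ (norm_nonneg _) (by linarith))
      obtain ⟨a, b, ha, hb, hab, rfl⟩ := hx
      have : a • y + b • z - y = b • (z - y) := by
        rw [show a = 1 - b by linarith]; module
      rw [this, norm_smul, Real.norm_of_nonneg hb]
      exact mul_le_of_le_one_left (norm_nonneg _) (by linarith)

/-- An autonomous equation with a bounded Lipschitz right-hand side has a solution which stays in
the ball of validity. -/
theorem exists_hasDerivWithinAt_mem_closedBall [CompleteSpace E] {f : E → E} {y₀ : E}
    {r L K : ℝ} (hL : 0 ≤ L) (hK : 0 ≤ K) (hr : L ≤ r)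
    (hf : ∀ y ∈ closedBall y₀ r, ‖f y‖ ≤ L)
    (hlip : ∀ y ∈ closedBall y₀ r, ∀ z ∈ closedBall y₀ r, ‖f z - f y‖ ≤ K * ‖z - y‖) :
    ∃ α : ℝ → E, α 0 = y₀ ∧ (∀ t, α t ∈ closedBall y₀ r) ∧
      ∀ t ∈ Icc (0 : ℝ) 1, HasDerivWithinAt α (f (α t)) (Icc 0 1) t := by
  lift L to NNReal using hL
  lift K to NNReal using hK
  lift r to NNReal using L.2.trans hr
  have hpl : IsPicardLindelof (fun _ ↦ f) (tmin := 0) (tmax := 1) ⟨0, by simp⟩ y₀ r 0 L K :=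
    .of_time_independent hf
      (LipschitzOnWith.of_dist_le_mul fun x hx y hy ↦ by
        rw [dist_eq_norm, dist_eq_norm]; exact hlip y hy x hx) (by simpa using hr)
  -- The Picard fixed point itself is kept, since it carries the confinement to the ball along with
  -- the equation.
  obtain ⟨α, hα⟩ := ODE.FunSpace.exists_isFixedPt_next hpl (mem_closedBall_self le_rfl)
  refine ⟨α.compProj, ?_, fun t ↦ α.compProj_mem_closedBall hpl.mul_max_le, fun t ht ↦ ?_⟩
  · have := ODE.FunSpace.compProj_val (α := α) (t := ⟨0, by simp⟩)
    rw [← hα, ODE.FunSpace.next_apply₀ hpl (mem_closedBall_self le_rfl), hα] at this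
    exact this
  · apply ODE.hasDerivWithinAt_picard_Icc (t₀ := 0) (by simp) hpl.continuousOn_uncurry
      α.continuous_compProj.continuousOn (fun _ _ ↦ α.compProj_mem_closedBall hpl.mul_max_le)
      y₀ ht |>.congr_of_mem _ ht
    intro t' ht'
    nth_rw 1 [← hα]
    rw [ODE.FunSpace.compProj_of_mem ht', ODE.FunSpace.next_apply]

/-- **Frobenius theorem**, for a frame of commuting vector fields `y ↦ T y a`. -/
theorem exists_hasFDerivAt_of_commuting [CompleteSpace E] {T : E → A →L[ℝ] E} {U : Set E} {y₀ : E}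
    (hU : U ∈ 𝓝 y₀) (hT : ContDiffAt ℝ 2 T y₀)
    (hcomm : ∀ y ∈ U, ∀ a b, fderiv ℝ T y (T y a) b = fderiv ℝ T y (T y b) a) :
    ∃ φ : A → E, ∃ δ > 0, φ 0 = y₀ ∧
      ∀ u ∈ ball (0 : A) δ, φ u ∈ U ∧ HasFDerivAt φ (T (φ u)) u := by
  obtain ⟨R, hR, C, hC, hRU, h1, h2⟩ := exists_uniform_taylor_bound hU hT
  have hC0 : 0 < C := by linarith
  -- For `‖v‖ < δ` the speed is at most `C * δ = R / 2`, so solutions stay in the ball of half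
  -- radius; the other half is room for the comparison curve `z`.
  set δ := R / 2 / C with hδ
  have hδ0 : 0 < δ := by positivity
  have hCδ : C * δ = R / 2 := by rw [hδ]; field_simp
  have hsub : closedBall y₀ (R / 2) ⊆ closedBall y₀ R := closedBall_subset_closedBall (by linarith)
  have key : ∀ v : A, ∃ α : ℝ → E, v ∈ ball (0 : A) δ → α 0 = y₀ ∧
      (∀ t, α t ∈ closedBall y₀ (R / 2)) ∧
      ∀ t ∈ Icc (0 : ℝ) 1, HasDerivWithinAt α (T (α t) v) (Icc 0 1) t := by
    intro v
    by_cases hv : v ∈ ball (0 : A) δ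
    swap
    · exact ⟨fun _ ↦ y₀, fun h ↦ absurd h hv⟩
    rw [mem_ball_zero_iff] at hv
    obtain ⟨α, hα⟩ := exists_hasDerivWithinAt_mem_closedBall (f := fun y ↦ T y v) (y₀ := y₀)
      (r := R / 2) (L := C * ‖v‖) (K := C * ‖v‖) (by positivity) (by positivity)
      (by rw [← hCδ]; gcongr)
      (fun y hy ↦ (T y).le_of_opNorm_le (h1 y (hsub hy)).2.1 v)
      (fun y hy z hz ↦ by
        have := (T z - T y).le_of_opNorm_le (h2 y (hsub hy) z (hsub hz)).1 v
        calc _ ≤ C * ‖z - y‖ * ‖v‖ := this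
          _ = _ := by ring)
    exact ⟨α, fun _ ↦ hα⟩
  choose α hα using key
  have h0 : α 0 1 = y₀ := by
    obtain ⟨a0, -, hd⟩ := hα 0 (mem_ball_self hδ0)
    rw [← a0]
    refine constant_of_has_deriv_right_zero (fun t ht ↦ (hd t ht).continuousWithinAt)
      (fun t ht ↦ ?_) 1 (by simp)
    have := (hd t (Ico_subset_Icc_self ht)).mono_of_mem_nhdsWithin
      (Icc_mem_nhdsGE_of_mem ht)
    simpa using this
  refine ⟨fun v ↦ α v 1, δ, hδ0, h0, fun v hv ↦ ⟨hRU (hsub ((hα v hv).2.1 1)), ?_⟩⟩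
  -- The summands are the coefficients of `‖w‖ ^ 2` in the error bounds `e1` and `e2` inside
  -- `hbound`.
  set M : ℝ := C ^ 2 + C ^ 3 * δ with hM
  have hM0 : 0 ≤ M := by positivity
  have est : ∀ w : A, v + w ∈ ball (0 : A) δ → ‖w‖ ≤ δ →
      ‖α (v + w) 1 - α v 1 - T (α v 1) w‖ ≤ M / R * (Real.exp R - 1) * ‖w‖ ^ 2 := by
    intro w hvw hw
    obtain ⟨a0, am, ad⟩ := hα v hv
    obtain ⟨b0, bm, bd⟩ := hα (v + w) hvw
    have hvw' := (mem_ball_zero_iff.1 hvw).le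
    -- First-order guess for the solution `α (v + w)`, with the same initial value. At `t = 1` their
    -- difference is the remainder to be estimated.
    set z : ℝ → E := fun t ↦ α v t + t • T (α v t) w with hz
    have hTw : ∀ t, ‖T (α v t) w‖ ≤ C * ‖w‖ := fun t ↦
      (T (α v t)).le_of_opNorm_le (h1 _ (hsub (am t))).2.1 w
    have hztw : ∀ t ∈ Icc (0 : ℝ) 1, ‖t • T (α v t) w‖ ≤ C * ‖w‖ := fun t ht ↦ by
      rw [norm_smul, Real.norm_of_nonneg ht.1]
      exact (mul_le_of_le_one_left (norm_nonneg _) ht.2).trans (hTw t)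
    have hzm : ∀ t ∈ Icc (0 : ℝ) 1, z t ∈ closedBall y₀ R := fun t ht ↦ by
      have e1 := mem_closedBall_iff_norm.1 (am t)
      have e2 : C * ‖w‖ ≤ R / 2 := by rw [← hCδ]; gcongr
      rw [mem_closedBall_iff_norm, hz, add_sub_right_comm]
      refine (norm_add_le _ _).trans ?_
      linarith [hztw t ht]
    set z' : ℝ → E := fun t ↦ T (α v t) v +
      (t • (fderiv ℝ T (α v t) (T (α v t) v)) w + T (α v t) w) with hz'
    have hzd : ∀ t ∈ Icc (0 : ℝ) 1, HasDerivWithinAt z (z' t) (Icc 0 1) t := fun t ht ↦ by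
      have e1 := (h1 _ (hsub (am t))).1.hasFDerivAt.comp_hasDerivWithinAt t (ad t ht)
      have e2 := e1.clm_apply (hasDerivWithinAt_const t (Icc (0 : ℝ) 1) w)
      have e3 := (hasDerivWithinAt_id t (Icc (0 : ℝ) 1)).smul e2
      refine ((ad t ht).add e3).congr_deriv ?_
      simp [hz']
    have hbound : ∀ t ∈ Ico (0 : ℝ) 1, dist (z' t) (T (z t) (v + w)) ≤ M * ‖w‖ ^ 2 := by
      intro t ht
      have ht' := Ico_subset_Icc_self ht
      set y := α v t
      set q := t • T y w with hq
      have hzy : z t - y = q := by simp [hz, y, hq]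
      have hrem := (h2 y (hsub (am t)) (z t) (hzm t ht')).2
      rw [hzy] at hrem
      have hdiff : z' t - T (z t) (v + w) =
          -(fderiv ℝ T y q w + (T (z t) - T y - fderiv ℝ T y q) (v + w)) := by
        -- Commutation makes the term coming from the motion of `y` equal to the linear part of `T
        -- (z t) - T y` applied to `v`; what survives is quadratic in `w`.
        have hsymm : (fderiv ℝ T y (T y v)) w = (fderiv ℝ T y (T y w)) v :=
          hcomm y (hRU (hsub (am t))) v w
        simp only [hz', hq, map_smul, map_add, smul_apply,
          sub_apply]
        rw [show α v t = y from rfl, hsymm]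
        module
      have e1 : ‖fderiv ℝ T y q w‖ ≤ C * (C * ‖w‖) * ‖w‖ :=
        (fderiv ℝ T y q).le_of_opNorm_le
          (((fderiv ℝ T y).le_of_opNorm_le (h1 _ (hsub (am t))).2.2 q).trans
            (mul_le_mul_of_nonneg_left (hztw t ht') hC0.le)) w
      have e2 : ‖(T (z t) - T y - fderiv ℝ T y q) (v + w)‖ ≤ C * (C * ‖w‖) ^ 2 * δ := by
        refine (ContinuousLinearMap.le_of_opNorm_le _ (hrem.trans
          (mul_le_mul_of_nonneg_left (pow_le_pow_left₀ (norm_nonneg _) (hztw t ht') 2) hC0.le))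
          _).trans ?_
        gcongr
      rw [dist_eq_norm, hdiff, norm_neg]
      refine (norm_add_le _ _).trans ((add_le_add e1 e2).trans (le_of_eq ?_))
      rw [hM]; ring
    have hgron := dist_le_of_approx_trajectories_ODE_of_mem (a := (0 : ℝ)) (b := 1)
      (v := fun _ y ↦ T y (v + w)) (s := fun _ ↦ closedBall y₀ R) (K := R.toNNReal)
      (f := z) (g := α (v + w)) (δ := 0) (εf := M * ‖w‖ ^ 2) (εg := 0)
      (g' := fun t ↦ T (α (v + w) t) (v + w))
      (fun t _ ↦ LipschitzOnWith.of_dist_le_mul fun x hx y hy ↦ by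
        rw [dist_eq_norm, dist_eq_norm, Real.coe_toNNReal R hR.le]
        refine ((T x - T y).le_of_opNorm_le (h2 y hy x hx).1 (v + w)).trans ?_
        calc _ = C * ‖v + w‖ * ‖x - y‖ := by ring
          _ ≤ C * δ * ‖x - y‖ := by gcongr
          _ ≤ R * ‖x - y‖ := by gcongr; linarith)
      (fun t ht ↦ (hzd t ht).continuousWithinAt)
      (fun t ht ↦ (hzd t (Ico_subset_Icc_self ht)).mono_of_mem_nhdsWithin
        (Icc_mem_nhdsGE_of_mem ht))
      hbound (fun t ht ↦ hzm t (Ico_subset_Icc_self ht))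
      (fun t ht ↦ (bd t ht).continuousWithinAt)
      (fun t ht ↦ (bd t (Ico_subset_Icc_self ht)).mono_of_mem_nhdsWithin
        (Icc_mem_nhdsGE_of_mem ht))
      (fun t _ ↦ by simp) (fun t _ ↦ hsub (bm t)) (by simp [hz, a0, b0]) 1 (by simp)
    rw [dist_comm, dist_eq_norm, Real.coe_toNNReal R hR.le,
      gronwallBound_of_K_ne_0 hR.ne'] at hgron
    have e1 : α (v + w) 1 - z 1 = α (v + w) 1 - α v 1 - T (α v 1) w := by
      simp [hz, sub_sub]
    rw [e1] at hgron
    refine hgron.trans (le_of_eq ?_)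
    simp
    ring
  rw [hasFDerivAt_iff_isLittleO_nhds_zero]
  have hO : (fun w ↦ α (v + w) 1 - α v 1 - T (α v 1) w) =O[𝓝 0] fun w : A ↦ ‖w‖ ^ 2 := by
    refine Asymptotics.IsBigO.of_bound (M / R * (Real.exp R - 1)) ?_
    have n1 : ∀ᶠ w in 𝓝 (0 : A), v + w ∈ ball (0 : A) δ :=
      (continuous_const.add continuous_id).continuousAt.eventually_mem
        (by simpa using isOpen_ball.mem_nhds hv)
    filter_upwards [n1, closedBall_mem_nhds (0 : A) hδ0] with w hw hw'
    simpa using est w hw (by simpa using hw')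
  exact hO.trans_isLittleO (Asymptotics.isLittleO_norm_pow_id one_lt_two)

end Calculus

/-! ### Integral manifolds and brackets in a vector space -/

section LocalFrobenius

open Metric

variable {A : Type*} [NormedAddCommGroup A] [NormedSpace ℝ A]
  {E : Type*} [NormedAddCommGroup E] [NormedSpace ℝ E]
  {P : Type*} [NormedAddCommGroup P] [NormedSpace ℝ P]

/-- A solution of `φ' = T ∘ φ` is as smooth as `T` allows. -/
theorem contDiffOn_of_hasFDerivAt_comp {T : E → A →L[ℝ] E} {U : Set E} {φ : A → E} {V : Set A}
    (hV : IsOpen V) (hT : ContDiffOn ℝ ∞ T U) (hφU : MapsTo φ V U)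
    (hφ : ∀ u ∈ V, HasFDerivAt φ (T (φ u)) u) : ContDiffOn ℝ ∞ φ V := by
  refine contDiffOn_infty.2 fun n ↦ ?_
  induction n with
  | zero =>
    exact contDiffOn_zero.2 fun u hu ↦ (hφ u hu).continuousAt.continuousWithinAt
  | succ n ih =>
    rw [Nat.cast_add, Nat.cast_one, contDiffOn_succ_iff_fderiv_of_isOpen hV]
    refine ⟨fun u hu ↦ (hφ u hu).differentiableAt.differentiableWithinAt, by simp, ?_⟩
    -- Bootstrapping: if `φ` is `C^n`, so is its derivative `T ∘ φ`.
    exact ((hT.of_le (mod_cast le_top)).comp ih hφU).congr fun u hu ↦ (hφ u hu).fderiv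

/-- A continuous family of linear maps which is injective at a point has a left inverse there
that remains one, up to an invertible factor, nearby. -/
theorem exists_eventually_isInvertible_comp [FiniteDimensional ℝ A] [FiniteDimensional ℝ E]
    {S : P → A →L[ℝ] E} {y₀ : P} (hS : ContinuousAt S y₀) (hinj : Function.Injective (S y₀)) :
    ∃ L : E →L[ℝ] A, ∀ᶠ y in 𝓝 y₀, (L ∘L S y).IsInvertible := by
  obtain ⟨g, hg⟩ := (S y₀ : A →ₗ[ℝ] E).exists_leftInverse_of_injective
    (LinearMap.ker_eq_bot.2 hinj)
  refine ⟨LinearMap.toContinuousLinearMap g, ?_⟩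
  set L := LinearMap.toContinuousLinearMap g
  have hid : L ∘L S y₀ = (ContinuousLinearEquiv.refl ℝ A : A →L[ℝ] A) := by
    ext a; exact LinearMap.congr_fun hg a
  have hc : ContinuousAt (fun y ↦ L ∘L S y) y₀ := continuousAt_const.clm_comp hS
  -- The invertible maps form a neighbourhood of the identity `L ∘L S y₀`.
  have := (ContinuousLinearEquiv.refl ℝ A).nhds
  rw [← hid] at this
  filter_upwards [hc this] with y hy
  obtain ⟨e, he⟩ := hy
  exact ⟨e, he⟩

/-- **Frobenius theorem** for the distribution spanned by the columns of `S`. -/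
theorem exists_integral_manifold [FiniteDimensional ℝ A] [FiniteDimensional ℝ E]
    {S : E → A →L[ℝ] E} {U : Set E} {y₀ : E} (hU : IsOpen U) (hy₀ : y₀ ∈ U)
    (hS : ContDiffOn ℝ ∞ S U) (hinj : ∀ y ∈ U, Function.Injective (S y))
    (hinv : ∀ y ∈ U, ∀ a b, fderiv ℝ S y (S y a) b - fderiv ℝ S y (S y b) a ∈ (S y).range) :
    ∃ (φ : A → E) (W : Set A), IsOpen W ∧ 0 ∈ W ∧ φ 0 = y₀ ∧ InjOn φ W ∧ MapsTo φ W U ∧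
      ContDiffOn ℝ ∞ φ W ∧ ∀ u ∈ W, ∃ φ' : A →L[ℝ] E, HasFDerivAt φ φ' u ∧
        Function.Injective φ' ∧ φ'.range = (S (φ u)).range := by
  have : CompleteSpace E := FiniteDimensional.complete ℝ E
  have : CompleteSpace A := FiniteDimensional.complete ℝ A
  obtain ⟨L, hL⟩ := exists_eventually_isInvertible_comp
    ((hS.continuousOn.continuousAt (hU.mem_nhds hy₀))) (hinj y₀ hy₀)
  obtain ⟨V, hVs, hV, hyV⟩ := _root_.mem_nhds_iff.1 (Filter.inter_mem (hU.mem_nhds hy₀) hL)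
  have hVU : V ⊆ U := fun y hy ↦ (hVs hy).1
  have hVi : ∀ y ∈ V, (L ∘L S y).IsInvertible := fun y hy ↦ (hVs hy).2
  -- Change of frame: `T` spans the same distribution as `S`, but `L ∘ T` is the identity, so `L`
  -- sends the new frame fields to constants.
  set R : E → A →L[ℝ] A := fun y ↦ (L ∘L S y).inverse with hR
  set T : E → A →L[ℝ] E := fun y ↦ S y ∘L R y with hT
  have hLSR : ∀ y ∈ V, ∀ a, L (S y (R y a)) = a := fun y hy a ↦ by
    obtain ⟨e, he⟩ := hVi y hy
    have : (L ∘L S y) (R y a) = a := by simp only [hR, ← he]; simp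
    exact this
  have hRLS : ∀ y ∈ V, ∀ a, R y (L (S y a)) = a := fun y hy a ↦ by
    obtain ⟨e, he⟩ := hVi y hy
    have : R y ((L ∘L S y) a) = a := by simp only [hR, ← he]; simp
    exact this
  have hSV : ∀ y ∈ V, ContDiffAt ℝ ∞ S y := fun y hy ↦ hS.contDiffAt (hU.mem_nhds (hVU hy))
  have hRV : ∀ y ∈ V, ContDiffAt ℝ ∞ R y := fun y hy ↦
    ((hVi y hy).contDiffAt_map_inverse (n := ∞)).comp y (f := fun y ↦ L ∘L S y)
      (contDiffAt_const.clm_comp (hSV y hy))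
  have hTV : ∀ y ∈ V, ContDiffAt ℝ ∞ T y := fun y hy ↦ (hSV y hy).clm_comp (hRV y hy)
  have hLT : ∀ y ∈ V, ∀ v b, L (fderiv ℝ T y v b) = 0 := fun y hy v b ↦ by
    have hd := ((hTV y hy).differentiableAt (by simp)).hasFDerivAt
    have h1 := (L.hasFDerivAt.comp y (hd.clm_apply (hasFDerivAt_const b y)))
    have h2 : HasFDerivAt (fun _ : E ↦ b) (0 : E →L[ℝ] A) y := hasFDerivAt_const b y
    have h3 := h1.unique (h2.congr_of_eventuallyEq (by
      filter_upwards [hV.mem_nhds hy] with z hz using hLSR z hz b))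
    simpa using DFunLike.congr_fun h3 v
  have hcomm : ∀ y ∈ V, ∀ a b, fderiv ℝ T y (T y a) b = fderiv ℝ T y (T y b) a := by
    intro y hy a b
    have hdS := ((hSV y hy).differentiableAt (by simp)).hasFDerivAt
    have hdR := ((hRV y hy).differentiableAt (by simp)).hasFDerivAt
    have hdT : ∀ v c, fderiv ℝ T y v c = fderiv ℝ S y v (R y c) + S y (fderiv ℝ R y v c) := by
      intro v c
      rw [(hdS.clm_comp hdR).fderiv]
      simp [add_comm]
    have hmem : fderiv ℝ T y (T y a) b - fderiv ℝ T y (T y b) a ∈ (S y).range := by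
      rw [hdT, hdT]
      have e1 := hinv y (hVU hy) (R y a) (R y b)
      have e2 : S y (fderiv ℝ R y (T y a) b - fderiv ℝ R y (T y b) a) ∈ (S y).range := ⟨_, rfl⟩
      have := Submodule.add_mem _ e1 e2
      rw [map_sub] at this
      convert this using 1
      simp only [hT, ContinuousLinearMap.comp_apply]
      abel
    -- The bracket of two normalised fields lies in the range of `S y`, where `L` is injective, and
    -- is killed by `L`; hence it vanishes.
    obtain ⟨c, hc⟩ := hmem
    have hc' : S y c = fderiv ℝ T y (T y a) b - fderiv ℝ T y (T y b) a := hc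
    have : c = 0 := by
      rw [← hRLS y hy c, hc', map_sub, hLT y hy, hLT y hy]; simp
    rw [this, map_zero] at hc'
    exact sub_eq_zero.1 hc'.symm
  obtain ⟨φ, δ, hδ, hφ0, hφ⟩ := exists_hasFDerivAt_of_commuting (hV.mem_nhds hyV)
    ((hTV y₀ hyV).of_le ENat.LEInfty.out) hcomm
  refine ⟨φ, ball 0 δ, isOpen_ball, mem_ball_self hδ, hφ0, ?_, fun u hu ↦ hVU (hφ u hu).1,
    contDiffOn_of_hasFDerivAt_comp isOpen_ball (fun y hy ↦ (hTV y hy).contDiffWithinAt)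
      (fun u hu ↦ (hφ u hu).1) (fun u hu ↦ (hφ u hu).2), fun u hu ↦ ⟨T (φ u), (hφ u hu).2, ?_, ?_⟩⟩
  -- `L ∘ φ - id` has zero derivative, so it is constant on the ball and `φ` is injective.
  · intro u hu v hv huv
    have hd : ∀ w ∈ ball (0 : A) δ,
        HasFDerivWithinAt (fun w ↦ L (φ w) - w) (0 : A →L[ℝ] A) (ball 0 δ) w := fun w hw ↦ by
      have h1 := (L.hasFDerivAt.comp w (hφ w hw).2).sub (hasFDerivAt_id w)
      refine (h1.congr_fderiv ?_).hasFDerivWithinAt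
      ext a
      simpa [sub_eq_zero, hT] using hLSR _ (hφ w hw).1 a
    have := (convex_ball (0 : A) δ).norm_image_sub_le_of_norm_hasFDerivWithin_le (C := 0)
      hd (by simp) hu hv
    simp only [huv, zero_mul, norm_le_zero_iff, sub_sub_sub_cancel_left] at this
    exact sub_eq_zero.1 this
  · intro a b hab
    rw [← hLSR _ (hφ u hu).1 a, ← hLSR _ (hφ u hu).1 b]
    exact congrArg L hab
  · ext w
    constructor
    · rintro ⟨a, rfl⟩; exact ⟨R (φ u) a, rfl⟩
    · rintro ⟨a, rfl⟩
      refine ⟨L (S (φ u) a), ?_⟩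
      change S (φ u) (R (φ u) (L (S (φ u) a))) = S (φ u) a
      rw [hRLS _ (hφ u hu).1]

/-- Vector fields tangent to an immersed submanifold have their bracket tangent to it. -/
theorem lieBracket_mem_range_fderiv [FiniteDimensional ℝ A] [FiniteDimensional ℝ E]
    {φ : A → E} {u₀ : A} {X Y : E → E} (hφ : ContDiffAt ℝ 2 φ u₀)
    (hinj : Function.Injective (fderiv ℝ φ u₀))
    (hX : DifferentiableAt ℝ X (φ u₀)) (hY : DifferentiableAt ℝ Y (φ u₀))
    (hXφ : ∀ᶠ u in 𝓝 u₀, X (φ u) ∈ (fderiv ℝ φ u).range)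
    (hYφ : ∀ᶠ u in 𝓝 u₀, Y (φ u) ∈ (fderiv ℝ φ u).range) :
    VectorField.lieBracket ℝ X Y (φ u₀) ∈ (fderiv ℝ φ u₀).range := by
  have : CompleteSpace A := FiniteDimensional.complete ℝ A
  have hφ' : ContDiffAt ℝ 1 (fderiv ℝ φ) u₀ := hφ.fderiv_right (by norm_num)
  have hd : DifferentiableAt ℝ φ u₀ := hφ.differentiableAt (by norm_num)
  obtain ⟨L, hL⟩ := exists_eventually_isInvertible_comp hφ'.continuousAt hinj
  -- A field tangent along `φ` is `φ`-related to a field on `A`, since `(L ∘ dφ)⁻¹ ∘ L` is a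
  -- differentiable left inverse of `dφ` near `u₀`.
  have lift : ∀ Z : E → E, DifferentiableAt ℝ Z (φ u₀) →
      (∀ᶠ u in 𝓝 u₀, Z (φ u) ∈ (fderiv ℝ φ u).range) → ∃ Z' : A → A,
        DifferentiableAt ℝ Z' u₀ ∧ ∀ᶠ u in 𝓝 u₀, fderiv ℝ φ u (Z' u) = Z (φ u) := by
    intro Z hZ hZφ
    refine ⟨fun u ↦ (L ∘L fderiv ℝ φ u).inverse (L (Z (φ u))), ?_, ?_⟩
    · have h1 : ContDiffAt ℝ 1 (fun u ↦ (L ∘L fderiv ℝ φ u).inverse) u₀ :=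
        (hL.self_of_nhds.contDiffAt_map_inverse (n := 1)).comp u₀ (f := fun u ↦ L ∘L fderiv ℝ φ u)
          (contDiffAt_const.clm_comp hφ')
      exact (h1.differentiableAt (by norm_num)).clm_apply
        (L.differentiableAt.comp u₀ (hZ.comp u₀ hd))
    · filter_upwards [hL, hZφ] with u hu ⟨c, hc⟩
      have hc' : fderiv ℝ φ u c = Z (φ u) := hc
      obtain ⟨e, he⟩ := hu
      rw [← hc']
      congr 1
      change (L ∘L fderiv ℝ φ u).inverse ((L ∘L fderiv ℝ φ u) c) = c
      rw [← he]; simp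
  obtain ⟨X', hX', hXX⟩ := lift X hX hXφ
  obtain ⟨Y', hY', hYY⟩ := lift Y hY hYφ
  have hdd : DifferentiableAt ℝ (fderiv ℝ φ) u₀ := hφ'.differentiableAt (by norm_num)
  have der : ∀ (Z : E → E) (Z' : A → A), DifferentiableAt ℝ Z (φ u₀) → DifferentiableAt ℝ Z' u₀ →
      (∀ᶠ u in 𝓝 u₀, fderiv ℝ φ u (Z' u) = Z (φ u)) → ∀ w, fderiv ℝ Z (φ u₀) (fderiv ℝ φ u₀ w) =
        fderiv ℝ (fderiv ℝ φ) u₀ w (Z' u₀) + fderiv ℝ φ u₀ (fderiv ℝ Z' u₀ w) := by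
    intro Z Z' hZ hZ' hZZ w
    have h1 := hdd.hasFDerivAt.clm_apply hZ'.hasFDerivAt
    have h2 := (hZ.hasFDerivAt.comp u₀ hd.hasFDerivAt).congr_of_eventuallyEq hZZ
    have := DFunLike.congr_fun (h2.unique h1) w
    simp at this
    rw [this, add_comm]
  have hs : IsSymmSndFDerivAt ℝ φ u₀ := hφ.isSymmSndFDerivAt (by simp)
  -- The preimage is `[X', Y']`: after differentiating the two relations, the second derivatives of
  -- `φ` cancel by symmetry.
  refine ⟨fderiv ℝ Y' u₀ (X' u₀) - fderiv ℝ X' u₀ (Y' u₀), ?_⟩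
  change fderiv ℝ φ u₀ _ = _
  rw [VectorField.lieBracket, ← hXX.self_of_nhds, ← hYY.self_of_nhds, der X X' hX hX' hXX,
    der Y Y' hY hY' hYY, hs.eq (X' u₀) (Y' u₀), map_sub]
  abel

end LocalFrobenius

/-! ### The Koszul formula for a pulled-back form -/

section Koszul

variable {E : Type*} [NormedAddCommGroup E] [NormedSpace ℝ E]
  {E' : Type*} [NormedAddCommGroup E'] [NormedSpace ℝ E']

set_option synthInstance.maxHeartbeats 200000 in
/-- For the pull-back under `G` of a field of symmetric bilinear forms (`K` being the field along
`G`), the terms of the Koszul formula other than `⟨[X, Y], V⟩` cancel at a point where `V` is in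
the kernel of the differential of `G`. -/
theorem koszul_pullback_of_fderiv_eq_zero {G : E → E'} {e : E} (hG : ContDiffAt ℝ 2 G e)
    {K : E → E' →L[ℝ] E' →L[ℝ] ℝ} (hK : DifferentiableAt ℝ K e)
    (hsymm : ∀ a b, K e a b = K e b a) {X Y V : E → E}
    (hX : DifferentiableAt ℝ X e) (hY : DifferentiableAt ℝ Y e) (hV : DifferentiableAt ℝ V e)
    (hGV : fderiv ℝ G e (V e) = 0) (hKV : fderiv ℝ K e (V e) = 0) :
    fderiv ℝ (fun y ↦ K y (fderiv ℝ G y (Y y)) (fderiv ℝ G y (V y))) e (X e)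
      + fderiv ℝ (fun y ↦ K y (fderiv ℝ G y (X y)) (fderiv ℝ G y (V y))) e (Y e)
      - fderiv ℝ (fun y ↦ K y (fderiv ℝ G y (X y)) (fderiv ℝ G y (Y y))) e (V e)
      - K e (fderiv ℝ G e (VectorField.lieBracket ℝ X V e)) (fderiv ℝ G e (Y e))
      - K e (fderiv ℝ G e (VectorField.lieBracket ℝ Y V e)) (fderiv ℝ G e (X e)) = 0 := by
  have hdd : DifferentiableAt ℝ (fderiv ℝ G) e :=
    (hG.fderiv_right (m := 1) (by norm_num)).differentiableAt (by norm_num)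
  have hs : IsSymmSndFDerivAt ℝ G e := hG.isSymmSndFDerivAt (by simp)
  have der : ∀ B D : E → E, DifferentiableAt ℝ B e → DifferentiableAt ℝ D e → ∀ w,
      fderiv ℝ (fun y ↦ K y (fderiv ℝ G y (B y)) (fderiv ℝ G y (D y))) e w =
        fderiv ℝ K e w (fderiv ℝ G e (B e)) (fderiv ℝ G e (D e)) +
        K e (fderiv ℝ (fderiv ℝ G) e w (B e) + fderiv ℝ G e (fderiv ℝ B e w))
          (fderiv ℝ G e (D e)) +
        K e (fderiv ℝ G e (B e))
          (fderiv ℝ (fderiv ℝ G) e w (D e) + fderiv ℝ G e (fderiv ℝ D e w)) := by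
    intro B D hB hD w
    have h1 := hK.hasFDerivAt.clm_apply (hdd.hasFDerivAt.clm_apply hB.hasFDerivAt)
    have h2 := h1.clm_apply (hdd.hasFDerivAt.clm_apply hD.hasFDerivAt)
    rw [h2.fderiv]
    simp
    ring
  -- Terms containing `dG(V)` or the derivative of `K` along `V` vanish. The second derivatives of
  -- `G` cancel in pairs by symmetry, and the derivatives of the fields cancel against the two
  -- brackets.
  rw [der Y V hY hV, der X V hX hV, der X Y hX hY, hGV, hKV, VectorField.lieBracket,
    VectorField.lieBracket, hs.eq (V e) (X e), hs.eq (V e) (Y e), hsymm (fderiv ℝ G e (X e)),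
    hsymm (fderiv ℝ G e (Y e))]
  simp [hsymm (fderiv ℝ G e (X e)) (fderiv ℝ (fderiv ℝ G) e (Y e) (V e)),
    hsymm (fderiv ℝ G e (X e)) (fderiv ℝ G e (fderiv ℝ Y e (V e)))]
  ring

end Koszul

/-! ### Vector fields in a chart -/

section ChartField

variable {E : Type*} [NormedAddCommGroup E] [NormedSpace ℝ E] [FiniteDimensional ℝ E]
  {M : Type*} [TopologicalSpace M] [ChartedSpace E M] [IsManifold 𝓘(ℝ, E) ∞ M]

/-- The differential of the inverse of the preferred chart at `p`. -/
def chartSymmDeriv (p : M) (y : E) :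
    E →L[ℝ] TangentSpace 𝓘(ℝ, E) ((extChartAt 𝓘(ℝ, E) p).symm y) :=
  mfderiv 𝓘(ℝ, E) 𝓘(ℝ, E) (extChartAt 𝓘(ℝ, E) p).symm y

/-- The representation of a vector field in the preferred chart at `p`. -/
def chartField (p : M) (X : Π x : M, TangentSpace 𝓘(ℝ, E) x) (y : E) : E :=
  (chartSymmDeriv p y).inverse (X ((extChartAt 𝓘(ℝ, E) p).symm y))

theorem isInvertible_chartSymmDeriv {p : M} {y : E} (hy : y ∈ (extChartAt 𝓘(ℝ, E) p).target) :
    (chartSymmDeriv p y).IsInvertible := by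
  have := isInvertible_mfderivWithin_extChartAt_symm (I := 𝓘(ℝ, E)) hy
  rw [modelWithCornersSelf_coe, range_id, mfderivWithin_univ] at this
  exact this

theorem chartSymmDeriv_injective {p : M} {y : E} (hy : y ∈ (extChartAt 𝓘(ℝ, E) p).target) :
    Function.Injective (chartSymmDeriv p y) := by
  obtain ⟨e, he⟩ := isInvertible_chartSymmDeriv hy
  rw [← he]; exact e.injective

theorem chartSymmDeriv_inverse {p : M} {y : E} (hy : y ∈ (extChartAt 𝓘(ℝ, E) p).target)
    (v : TangentSpace 𝓘(ℝ, E) ((extChartAt 𝓘(ℝ, E) p).symm y)) :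
    chartSymmDeriv p y ((chartSymmDeriv p y).inverse v) = v :=
   ((isInvertible_chartSymmDeriv hy).inverse_apply_eq.1 rfl).symm

theorem chartSymmDeriv_chartField {p : M} {y : E} (hy : y ∈ (extChartAt 𝓘(ℝ, E) p).target)
    (X : Π x : M, TangentSpace 𝓘(ℝ, E) x) :
    chartSymmDeriv p y (chartField p X y) = X ((extChartAt 𝓘(ℝ, E) p).symm y) :=
  chartSymmDeriv_inverse hy _

theorem contMDiffAt_extChartAt_symm {p : M} {y : E} (hy : y ∈ (extChartAt 𝓘(ℝ, E) p).target) :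
    ContMDiffAt 𝓘(ℝ, E) 𝓘(ℝ, E) ∞ (extChartAt 𝓘(ℝ, E) p).symm y :=
  (contMDiffOn_extChartAt_symm p).contMDiffAt ((isOpen_extChartAt_target p).mem_nhds hy)

/-- `chartField p X` unfolds to the pullback of `X` under the inverse chart, and pullbacks of smooth
fields by local diffeomorphisms are smooth. -/
theorem contDiffAt_chartField {p : M} {y : E} (hy : y ∈ (extChartAt 𝓘(ℝ, E) p).target)
    {X : Π x : M, TangentSpace 𝓘(ℝ, E) x}
    (hX : ContMDiffAt 𝓘(ℝ, E) 𝓘(ℝ, E).tangent ∞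
      (fun x ↦ (⟨x, X x⟩ : TangentBundle 𝓘(ℝ, E) M)) ((extChartAt 𝓘(ℝ, E) p).symm y)) :
    ContDiffAt ℝ ∞ (chartField p X) y := by
  have h := ContMDiffAt.mpullback_vectorField_preimage hX (contMDiffAt_extChartAt_symm hy)
    (isInvertible_chartSymmDeriv (E := E) hy) le_rfl
  exact contMDiffAt_vectorSpace_iff_contDiffAt.1 h

theorem differentiableAt_chartField {p : M} {y : E} (hy : y ∈ (extChartAt 𝓘(ℝ, E) p).target)
    {X : Π x : M, TangentSpace 𝓘(ℝ, E) x} (hX : MDiffAt (T% X) ((extChartAt 𝓘(ℝ, E) p).symm y)) :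
    DifferentiableAt ℝ (chartField p X) y := by
  have h := MDifferentiableAt.mpullback_vectorField hX
    ((contMDiffAt_extChartAt_symm hy).of_le (ENat.LEInfty.out : (2 : ℕ∞ω) ≤ ∞))
    (isInvertible_chartSymmDeriv (E := E) hy) le_rfl
  exact (((contMDiff_snd_tangentBundle_modelSpace E 𝓘(ℝ, E) (n := 1)).contMDiffAt.mdifferentiableAt
    one_ne_zero).comp y h).differentiableAt

theorem chartField_mlieBracket {p : M} {y : E} (hy : y ∈ (extChartAt 𝓘(ℝ, E) p).target)
    {X Y : Π x : M, TangentSpace 𝓘(ℝ, E) x}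
    (hX : MDiffAt (T% X) ((extChartAt 𝓘(ℝ, E) p).symm y))
    (hY : MDiffAt (T% Y) ((extChartAt 𝓘(ℝ, E) p).symm y)) :
    chartField p (VectorField.mlieBracket 𝓘(ℝ, E) X Y) y =
      VectorField.lieBracket ℝ (chartField p X) (chartField p Y) y := by
  have : IsManifold 𝓘(ℝ, E) (minSmoothness ℝ 3) M := by
    rw [minSmoothness_of_isRCLikeNormedField]; infer_instance
  have h := VectorField.mpullback_mlieBracket hX hY (contMDiffAt_extChartAt_symm hy)
    (by simpa using (ENat.LEInfty.out : (2 : ℕ∞ω) ≤ ∞))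
  rw [← VectorField.mlieBracketWithin_univ (I := 𝓘(ℝ, E)) (M := E),
    VectorField.mlieBracketWithin_eq_lieBracketWithin] at h
  exact h.trans (congrFun VectorField.lieBracketWithin_univ y)

/-- Chain rule for `f = χ⁻¹ ∘ (χ ∘ f)` near `u`. The equality is read in `E` because the two sides
live in tangent spaces at points that are only propositionally equal. -/
theorem chartSymmDeriv_fderiv_extChartAt_comp {B : Type*} [NormedAddCommGroup B] [NormedSpace ℝ B]
    {p : M} {f : B → M} {u : B} (hf : MDifferentiableAt 𝓘(ℝ, B) 𝓘(ℝ, E) f u)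
    (hu : f u ∈ (extChartAt 𝓘(ℝ, E) p).source) (c : B) :
    (chartSymmDeriv p (extChartAt 𝓘(ℝ, E) p (f u)) (fderiv ℝ (extChartAt 𝓘(ℝ, E) p ∘ f) u c) : E) =
      mfderiv 𝓘(ℝ, B) 𝓘(ℝ, E) f u c := by
  have h1 : MDifferentiableAt 𝓘(ℝ, B) 𝓘(ℝ, E) (extChartAt 𝓘(ℝ, E) p ∘ f) u :=
    (mdifferentiableAt_extChartAt (by simpa using hu)).comp u hf
  have h2 : MDifferentiableAt 𝓘(ℝ, E) 𝓘(ℝ, E) (extChartAt 𝓘(ℝ, E) p).symm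
      ((extChartAt 𝓘(ℝ, E) p ∘ f) u) :=
    (contMDiffAt_extChartAt_symm ((extChartAt 𝓘(ℝ, E) p).map_source hu)).mdifferentiableAt
      (by simp)
  have h3 := mfderiv_comp u h2 h1
  have h4 : (extChartAt 𝓘(ℝ, E) p).symm ∘ extChartAt 𝓘(ℝ, E) p ∘ f =ᶠ[𝓝 u] f := by
    filter_upwards [hf.continuousAt.preimage_mem_nhds ((isOpen_extChartAt_source p).mem_nhds hu)]
      with w hw using (extChartAt 𝓘(ℝ, E) p).left_inv hw
  rw [h4.mfderiv_eq, mfderiv_eq_fderiv] at h3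
  exact (DFunLike.congr_fun h3 c).symm

end ChartField

/-! ### The Frobenius theorem on a manifold -/

section Integrability

variable {E : Type*} [NormedAddCommGroup E] [NormedSpace ℝ E] [FiniteDimensional ℝ E]
  {M : Type*} [TopologicalSpace M] [ChartedSpace E M] [IsManifold 𝓘(ℝ, E) ∞ M]

/-- Brackets of sections of `D` are sections of `D`. -/
def IsInvolutive (D : Π x : M, Submodule ℝ (TangentSpace 𝓘(ℝ, E) x)) : Prop :=
  ∀ X Y : Π x : M, TangentSpace 𝓘(ℝ, E) x, IsSectionOf D X → IsSectionOf D Y →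
    ∀ x, VectorField.mlieBracket 𝓘(ℝ, E) X Y x ∈ D x

theorem IsSectionOf.mdifferentiableAt {D : Π x : M, Submodule ℝ (TangentSpace 𝓘(ℝ, E) x)}
    {X : Π x : M, TangentSpace 𝓘(ℝ, E) x} (hX : IsSectionOf D X) (x : M) : MDiffAt (T% X) x :=
  (hX.1 x).mdifferentiableAt (by simp)

/-- Sections of `D` are tangent to the integral manifold through the given point, hence so is their
bracket; `lieBracket_mem_range_fderiv` is applied in a chart. -/
theorem IsIntegrable.isInvolutive {D : Π x : M, Submodule ℝ (TangentSpace 𝓘(ℝ, E) x)}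
    (hD : IsIntegrable D) : IsInvolutive D := by
  intro X Y hX hY p
  obtain ⟨k, W, φ, hW, ⟨u₀, hu₀, rfl⟩, -, hφ, hφD⟩ := hD p
  set χ := extChartAt 𝓘(ℝ, E) (φ u₀) with hχ
  have hφW : ∀ u ∈ W, ContMDiffAt 𝓘(ℝ, EuclideanSpace ℝ (Fin k)) 𝓘(ℝ, E) ∞ φ u :=
    fun u hu ↦ hφ.contMDiffAt (hW.mem_nhds hu)
  have hsrc : φ u₀ ∈ χ.source := mem_extChartAt_source _
  have htgt : χ (φ u₀) ∈ χ.target := χ.map_source hsrc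
  have hsymm : χ.symm (χ (φ u₀)) = φ u₀ := χ.left_inv hsrc
  have hev : ∀ᶠ u in 𝓝 u₀, u ∈ W ∧ φ u ∈ χ.source :=
    (hW.eventually_mem hu₀).and
      ((hφW u₀ hu₀).continuousAt.preimage_mem_nhds (extChartAt_source_mem_nhds _))
  have hder : ∀ u ∈ W, φ u ∈ χ.source → ∀ c,
      (chartSymmDeriv (φ u₀) (χ (φ u)) (fderiv ℝ (χ ∘ φ) u c) : E) =
        mfderiv 𝓘(ℝ, EuclideanSpace ℝ (Fin k)) 𝓘(ℝ, E) φ u c := fun u hu hs c ↦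
    chartSymmDeriv_fderiv_extChartAt_comp ((hφW u hu).mdifferentiableAt (by simp)) hs c
  have hsmooth : ContDiffAt ℝ 2 (χ ∘ φ) u₀ := by
    have : ContMDiffAt 𝓘(ℝ, EuclideanSpace ℝ (Fin k)) 𝓘(ℝ, E) ∞ (χ ∘ φ) u₀ :=
      contMDiffAt_extChartAt.comp u₀ (hφW u₀ hu₀)
    exact this.contDiffAt.of_le ENat.LEInfty.out
  have hinj : Function.Injective (fderiv ℝ (χ ∘ φ) u₀) := by
    intro a b hab
    apply (hφD u₀ hu₀).1
    rw [← hder u₀ hu₀ hsrc, ← hder u₀ hu₀ hsrc, hab]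
  have hmem : ∀ Z : Π x : M, TangentSpace 𝓘(ℝ, E) x, IsSectionOf D Z →
      ∀ᶠ u in 𝓝 u₀, chartField (φ u₀) Z ((χ ∘ φ) u) ∈ (fderiv ℝ (χ ∘ φ) u).range := by
    intro Z hZ
    filter_upwards [hev] with u hu
    have h1 := hZ.2 (φ u)
    rw [← (hφD u hu.1).2] at h1
    obtain ⟨c, hc⟩ := h1
    refine ⟨c, chartSymmDeriv_injective (χ.map_source hu.2) ?_⟩
    have h2 : (chartSymmDeriv (φ u₀) (χ (φ u)) (chartField (φ u₀) Z (χ (φ u))) : E) =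
        Z (φ u) := by
      have := chartSymmDeriv_chartField (χ.map_source hu.2) Z
      exact this.trans (congrArg (fun q ↦ (Z q : E)) (χ.left_inv hu.2))
    exact (hder u hu.1 hu.2 c).trans (hc.trans h2.symm)
  have hdiff : ∀ Z : Π x : M, TangentSpace 𝓘(ℝ, E) x, IsSectionOf D Z →
      DifferentiableAt ℝ (chartField (φ u₀) Z) ((χ ∘ φ) u₀) := fun Z hZ ↦
    differentiableAt_chartField htgt (hZ.mdifferentiableAt _)
  have hbr := lieBracket_mem_range_fderiv hsmooth hinj (hdiff X hX) (hdiff Y hY)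
    (hmem X hX) (hmem Y hY)
  obtain ⟨c, hc⟩ := hbr
  rw [← (hφD u₀ hu₀).2]
  refine ⟨c, (hder u₀ hu₀ hsrc c).symm.trans ?_⟩
  have h1 := chartField_mlieBracket htgt (hX.mdifferentiableAt _) (hY.mdifferentiableAt _)
  have h2 := chartSymmDeriv_chartField htgt (VectorField.mlieBracket 𝓘(ℝ, E) X Y)
  rw [h1] at h2
  refine (congrArg (fun v ↦ (chartSymmDeriv (φ u₀) (χ (φ u₀)) v : E)) hc).trans ?_
  exact h2.trans (congrArg (fun q ↦ (VectorField.mlieBracket 𝓘(ℝ, E) X Y q : E)) hsymm)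

/-- Brackets of local sections of an involutive distribution are in the distribution. -/
theorem IsInvolutive.mlieBracket_mem [T2Space M]
    {D : Π x : M, Submodule ℝ (TangentSpace 𝓘(ℝ, E) x)} (hD : IsInvolutive D)
    {U : Set M} (hU : IsOpen U) {X Y : Π x : M, TangentSpace 𝓘(ℝ, E) x}
    (hX : ContMDiffOn 𝓘(ℝ, E) 𝓘(ℝ, E).tangent ∞
      (fun x ↦ (⟨x, X x⟩ : TangentBundle 𝓘(ℝ, E) M)) U) (hXD : ∀ x ∈ U, X x ∈ D x)
    (hY : ContMDiffOn 𝓘(ℝ, E) 𝓘(ℝ, E).tangent ∞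
      (fun x ↦ (⟨x, Y x⟩ : TangentBundle 𝓘(ℝ, E) M)) U) (hYD : ∀ x ∈ U, Y x ∈ D x)
    {q : M} (hq : q ∈ U) : VectorField.mlieBracket 𝓘(ℝ, E) X Y q ∈ D q := by
  -- Multiplication by a bump function supported in `U` gives global sections with the same germs at
  -- `q`, and the bracket depends only on germs.
  obtain ⟨f, hf⟩ := (SmoothBumpFunction.nhds_basis_tsupport (I := 𝓘(ℝ, E)) q).mem_iff.1
    (hU.mem_nhds hq)
  have hsec : ∀ Z : Π x : M, TangentSpace 𝓘(ℝ, E) x, ContMDiffOn 𝓘(ℝ, E) 𝓘(ℝ, E).tangent ∞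
      (fun x ↦ (⟨x, Z x⟩ : TangentBundle 𝓘(ℝ, E) M)) U → (∀ x ∈ U, Z x ∈ D x) →
      IsSectionOf D (fun x ↦ f x • Z x) ∧ Z =ᶠ[𝓝 q] (fun x ↦ f x • Z x) := by
    intro Z hZ hZD
    refine ⟨⟨ContMDiffOn.smul_section_of_tsupport f.contMDiff.contMDiffOn hU hf.2 hZ, fun x ↦ ?_⟩,
      ?_⟩
    · by_cases hx : x ∈ U
      · exact Submodule.smul_mem _ _ (hZD x hx)
      · have : f x = 0 := image_eq_zero_of_notMem_tsupport fun h ↦ hx (hf.2 h)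
        change f x • Z x ∈ D x
        rw [this, zero_smul]; exact Submodule.zero_mem _
    · filter_upwards [f.eventuallyEq_one] with x hx
      simp only [hx, Pi.one_apply]
      exact (one_smul ℝ (Z x)).symm
  obtain ⟨hX1, hX2⟩ := hsec X hX hXD
  obtain ⟨hY1, hY2⟩ := hsec Y hY hYD
  rw [hX2.mlieBracket_vectorField_eq hY2]
  exact hD _ _ hX1 hY1 q

/-- In a chart a local frame of `D` becomes the columns of a map `S`; the integral manifold found
there for `S` is carried back by the inverse chart. -/
theorem IsInvolutive.isIntegrable [T2Space M]
    {D : Π x : M, Submodule ℝ (TangentSpace 𝓘(ℝ, E) x)} (hD : IsInvolutive D)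
    (hsm : IsSmoothDistribution D) : IsIntegrable D := by
  intro p
  obtain ⟨k, U, s, hU, hpU, hs, hsD⟩ := hsm p
  set χ := extChartAt 𝓘(ℝ, E) p with hχ
  have htgt : IsOpen χ.target := isOpen_extChartAt_target p
  set V : Set E := χ.target ∩ χ.symm ⁻¹' U with hV
  have hVo : IsOpen V := (continuousOn_extChartAt_symm p).isOpen_inter_preimage htgt hU
  have hpV : χ p ∈ V := ⟨mem_extChartAt_target p, by
    rw [mem_preimage, extChartAt_to_inv]; exact hpU⟩
  set S : E → EuclideanSpace ℝ (Fin k) →L[ℝ] E := fun y ↦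
    ∑ i, (EuclideanSpace.proj i : EuclideanSpace ℝ (Fin k) →L[ℝ] ℝ).smulRight
      (chartField p (s i) y) with hS
  have hSa : ∀ y a, S y a = ∑ i, a i • chartField p (s i) y := fun y a ↦ by
    simp [hS]
  have hsmooth : ∀ i, ∀ y ∈ V, ContDiffAt ℝ ∞ (chartField p (s i)) y := fun i y hy ↦
    contDiffAt_chartField hy.1 ((hs i).contMDiffAt (hU.mem_nhds hy.2))
  have hmd : ∀ i, ∀ y ∈ V, MDiffAt (T% (s i)) (χ.symm y) := fun i y hy ↦
    ((hs i).contMDiffAt (hU.mem_nhds hy.2)).mdifferentiableAt (by simp)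
  have hSs : ∀ y ∈ V, ContDiffAt ℝ ∞ S y := fun y hy ↦
    ContDiffAt.sum fun i _ ↦ contDiffAt_const.smulRight (hsmooth i y hy)
  have hdS : ∀ y ∈ V, ∀ v b, fderiv ℝ S y v b = ∑ i, b i • fderiv ℝ (chartField p (s i)) y v := by
    intro y hy v b
    have h1 := ((hSs y hy).differentiableAt (by simp)).hasFDerivAt.clm_apply
      (hasFDerivAt_const b y)
    have h2 : HasFDerivAt (fun y ↦ S y b)
        (∑ i, b i • fderiv ℝ (chartField p (s i)) y) y := by
      simp only [hSa]
      exact HasFDerivAt.fun_sum fun i _ ↦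
        ((hsmooth i y hy).differentiableAt (by simp)).hasFDerivAt.const_smul (b i)
    have := DFunLike.congr_fun (h1.unique h2) v
    simpa using this
  have hdS' : ∀ y ∈ V, ∀ a, (chartSymmDeriv p y (S y a) : E) = ∑ i, a i • s i (χ.symm y) := by
    intro y hy a
    rw [hSa, map_sum]
    refine Finset.sum_congr rfl fun i _ ↦ ?_
    rw [map_smul, chartSymmDeriv_chartField hy.1]
  have hrange : ∀ y ∈ V, ∀ v : E, chartSymmDeriv p y v ∈ D (χ.symm y) ↔ v ∈ (S y).range := by
    intro y hy v
    rw [← (hsD _ hy.2).2, Submodule.mem_span_range_iff_exists_fun]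
    constructor
    · rintro ⟨c, hc⟩
      refine ⟨WithLp.toLp 2 c, chartSymmDeriv_injective hy.1 ?_⟩
      exact (hdS' y hy (WithLp.toLp 2 c)).trans hc
    · rintro ⟨a, rfl⟩
      exact ⟨a, (hdS' y hy a).symm⟩
  have hinj : ∀ y ∈ V, Function.Injective (S y) := by
    intro y hy a b hab
    have h1 : ∑ i, a i • s i (χ.symm y) = ∑ i, b i • s i (χ.symm y) := by
      rw [← hdS' y hy a, ← hdS' y hy b, hab]
    have h2 := (Fintype.linearIndependent_iffₛ.1 (hsD _ hy.2).1) a b h1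
    ext i; exact h2 i
  have hbr : ∀ y ∈ V, ∀ i j, VectorField.lieBracket ℝ (chartField p (s i)) (chartField p (s j)) y ∈
      (S y).range := by
    intro y hy i j
    rw [← hrange y hy, ← chartField_mlieBracket hy.1 (hmd i y hy) (hmd j y hy),
      chartSymmDeriv_chartField hy.1]
    have hmem : ∀ i, ∀ x ∈ U, s i x ∈ D x := fun i x hx ↦ by
      rw [← (hsD x hx).2]; exact Submodule.subset_span ⟨i, rfl⟩
    exact hD.mlieBracket_mem hU (hs i) (hmem i) (hs j) (hmem j) hy.2
  have hinv : ∀ y ∈ V, ∀ a b, fderiv ℝ S y (S y a) b - fderiv ℝ S y (S y b) a ∈ (S y).range := by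
    intro y hy a b
    -- The coefficients `a`, `b` are constant, so the bracket of the combined fields is bilinear in
    -- the brackets of the frame.
    have : fderiv ℝ S y (S y a) b - fderiv ℝ S y (S y b) a = ∑ i, ∑ j, (a i * b j) •
        VectorField.lieBracket ℝ (chartField p (s i)) (chartField p (s j)) y := by
      simp only [VectorField.lieBracket, smul_sub, Finset.sum_sub_distrib]
      rw [hdS y hy, hdS y hy, hSa, hSa]
      congr 1
      · rw [Finset.sum_comm]
        simp [Finset.smul_sum, smul_smul, mul_comm]
      · simp [Finset.smul_sum, smul_smul]
    rw [this]
    exact Submodule.sum_mem _ fun i _ ↦ Submodule.sum_mem _ fun j _ ↦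
      Submodule.smul_mem _ _ (hbr y hy i j)
  obtain ⟨φ, W, hW, h0, hφ0, hφi, hφV, hφs, hφd⟩ := exists_integral_manifold hVo hpV
    (fun y hy ↦ (hSs y hy).contDiffWithinAt) hinj hinv
  have htgtV : MapsTo φ W χ.target := fun u hu ↦ (hφV hu).1
  refine ⟨k, W, χ.symm ∘ φ, hW, ⟨0, h0, by simp [hφ0, hχ]⟩, ?_, ?_, ?_⟩
  · exact χ.symm.injOn.comp hφi htgtV
  · exact (contMDiffOn_extChartAt_symm p).comp hφs.contMDiffOn htgtV
  · intro u hu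
    obtain ⟨φ', hφ', hφ'i, hφ'r⟩ := hφd u hu
    have hm : mfderiv 𝓘(ℝ, EuclideanSpace ℝ (Fin k)) 𝓘(ℝ, E) (χ.symm ∘ φ) u =
        chartSymmDeriv p (φ u) ∘L φ' :=
      ((((contMDiffAt_extChartAt_symm (htgtV hu)).mdifferentiableAt (by simp)).hasMFDerivAt).comp u
        hφ'.hasMFDerivAt).mfderiv
    rw [hm]
    refine ⟨(chartSymmDeriv_injective (htgtV hu)).comp hφ'i, ?_⟩
    ext v
    constructor
    · rintro ⟨a, rfl⟩
      exact (hrange _ (hφV hu) _).2 (hφ'r ▸ ⟨a, rfl⟩)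
    · intro hv
      have hv' := chartSymmDeriv_inverse (htgtV hu) v
      have hv2 : chartSymmDeriv p (φ u) ((chartSymmDeriv p (φ u)).inverse v) ∈ D (χ.symm (φ u)) := by
        rw [hv']; exact hv
      have := (hrange _ (hφV hu) _).1 hv2
      rw [← hφ'r] at this
      obtain ⟨a, ha⟩ := this
      refine ⟨a, ?_⟩
      refine Eq.trans ?_ hv'
      exact congrArg (fun w ↦ chartSymmDeriv p (φ u) w) ha

/-- The **Frobenius theorem**. -/
theorem isIntegrable_iff_isInvolutive [T2Space M]
    {D : Π x : M, Submodule ℝ (TangentSpace 𝓘(ℝ, E) x)} (hsm : IsSmoothDistribution D) :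
    IsIntegrable D ↔ IsInvolutive D :=
  ⟨fun h ↦ h.isInvolutive, fun h ↦ h.isIntegrable hsm⟩

end Integrability

/-! ### The metric in a chart -/

section MetricInChart

variable {E : Type*} [NormedAddCommGroup E] [NormedSpace ℝ E] [FiniteDimensional ℝ E]
  {M : Type*} [TopologicalSpace M] [ChartedSpace E M] [IsManifold 𝓘(ℝ, E) ∞ M]

theorem fderiv_comp_extChartAt_symm {p : M} {y : E} (hy : y ∈ (extChartAt 𝓘(ℝ, E) p).target)
    {f : M → ℝ} (hf : MDifferentiableAt 𝓘(ℝ, E) 𝓘(ℝ, ℝ) f ((extChartAt 𝓘(ℝ, E) p).symm y))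
    (Z : Π x : M, TangentSpace 𝓘(ℝ, E) x) :
    fderiv ℝ (fun y ↦ f ((extChartAt 𝓘(ℝ, E) p).symm y)) y (chartField p Z y) =
      mvfderiv 𝓘(ℝ, E) f ((extChartAt 𝓘(ℝ, E) p).symm y)
        (Z ((extChartAt 𝓘(ℝ, E) p).symm y)) := by
  have h := mfderiv_comp y hf ((contMDiffAt_extChartAt_symm hy).mdifferentiableAt (by simp))
  rw [mfderiv_eq_fderiv] at h
  refine (DFunLike.congr_fun h (chartField p Z y)).trans ?_
  exact congrArg (mvfderiv 𝓘(ℝ, E) f _) (chartSymmDeriv_chartField hy Z)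

variable [RiemannianBundle (fun x : M ↦ TangentSpace 𝓘(ℝ, E) x)]

/-- Transports inner products along an equality of base points such as `ψ⁻¹(ψ(F x)) = F x`, all
tangent spaces unfolding to `E`. -/
theorem inner_eq_of_eq {q q' : M} (hq : q = q') {v w : TangentSpace 𝓘(ℝ, E) q}
    {v' w' : TangentSpace 𝓘(ℝ, E) q'} (hv : (v : E) = v') (hw : (w : E) = w') :
    inner ℝ v w = inner ℝ v' w' := by
  subst hq
  exact congrArg₂ _ hv hw

/-- The metric in the preferred chart at `p`. -/
def metricInChart (p : M) (y : E) : E →L[ℝ] E →L[ℝ] ℝ :=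
  LinearMap.toContinuousLinearMap
    ((LinearMap.toContinuousLinearMap : (E →ₗ[ℝ] ℝ) ≃ₗ[ℝ] (E →L[ℝ] ℝ)).toLinearMap ∘ₗ
      LinearMap.mk₂ ℝ (fun v w ↦ inner ℝ (chartSymmDeriv p y v) (chartSymmDeriv p y w))
        (fun _ _ _ ↦ by rw [map_add, inner_add_left])
        (fun _ _ _ ↦ by rw [map_smul, real_inner_smul_left]; rfl)
        (fun _ _ _ ↦ by rw [map_add, inner_add_right])
        (fun _ _ _ ↦ by rw [map_smul, real_inner_smul_right]; rfl))

theorem metricInChart_apply (p : M) (y v w : E) :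
    metricInChart p y v w = inner ℝ (chartSymmDeriv p y v) (chartSymmDeriv p y w) := rfl

theorem metricInChart_comm (p : M) (y v w : E) :
    metricInChart p y v w = metricInChart p y w v := by
  rw [metricInChart_apply, metricInChart_apply, real_inner_comm]

variable [IsContMDiffRiemannianBundle 𝓘(ℝ, E) ∞ E (fun x : M ↦ TangentSpace 𝓘(ℝ, E) x)]

-- In finite dimension smoothness can be tested on fixed vectors `v`, `w`, which the inverse chart
-- carries to smooth sections.
set_option synthInstance.maxHeartbeats 200000 in
theorem contDiffOn_metricInChart (p : M) :
    ContDiffOn ℝ ∞ (metricInChart p) (extChartAt 𝓘(ℝ, E) p).target := by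
  have hsec : ∀ v : E, ContMDiffOn 𝓘(ℝ, E) 𝓘(ℝ, E).tangent ∞
      (fun y ↦ (⟨(extChartAt 𝓘(ℝ, E) p).symm y, chartSymmDeriv p y v⟩ : TangentBundle 𝓘(ℝ, E) M))
      (extChartAt 𝓘(ℝ, E) p).target := by
    intro v
    have ho := isOpen_extChartAt_target (I := 𝓘(ℝ, E)) p
    have h1 := (contMDiffOn_extChartAt_symm (I := 𝓘(ℝ, E)) (n := ∞) p).contMDiffOn_tangentMapWithin
      (m := ∞) le_rfl ho.uniqueMDiffOn
    have h2 : ContMDiff 𝓘(ℝ, E) 𝓘(ℝ, E).tangent ∞ (fun y : E ↦ (⟨y, v⟩ : TangentBundle 𝓘(ℝ, E) E)) :=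
      contMDiff_vectorSpace_iff_contDiff.2 contDiff_const
    refine (h1.comp h2.contMDiffOn (fun y hy ↦ hy)).congr fun y hy ↦ ?_
    simp only [Function.comp_apply, tangentMapWithin, mfderivWithin_of_isOpen ho hy]
    rfl
  refine contDiffOn_clm_apply.2 fun v ↦ contDiffOn_clm_apply.2 fun w ↦ ?_
  have h : ContMDiffOn 𝓘(ℝ, E) 𝓘(ℝ, ℝ) ∞
      (fun y ↦ inner ℝ (chartSymmDeriv p y v) (chartSymmDeriv p y w))
      (extChartAt 𝓘(ℝ, E) p).target :=
    ContMDiffOn.inner_bundle (IB := 𝓘(ℝ, E)) (F := E) (E := fun x : M ↦ TangentSpace 𝓘(ℝ, E) x)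
      (b := fun y : E ↦ (extChartAt 𝓘(ℝ, E) p).symm y) (v := fun y ↦ chartSymmDeriv p y v)
      (w := fun y ↦ chartSymmDeriv p y w) (hsec v) (hsec w)
  exact h.contDiffOn

end MetricInChart

/-! ### O'Neill's lemma -/

section HorizontalKoszul

variable {E : Type*} [NormedAddCommGroup E] [NormedSpace ℝ E] [FiniteDimensional ℝ E]
  {E' : Type*} [NormedAddCommGroup E'] [NormedSpace ℝ E'] [FiniteDimensional ℝ E']
  {M : Type*} [TopologicalSpace M] [ChartedSpace E M] [IsManifold 𝓘(ℝ, E) ∞ M]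
  [RiemannianBundle (fun x : M ↦ TangentSpace 𝓘(ℝ, E) x)]
  [IsContMDiffRiemannianBundle 𝓘(ℝ, E) ∞ E (fun x : M ↦ TangentSpace 𝓘(ℝ, E) x)]
  {N : Type*} [TopologicalSpace N] [ChartedSpace E' N] [IsManifold 𝓘(ℝ, E') ∞ N]
  [RiemannianBundle (fun y : N ↦ TangentSpace 𝓘(ℝ, E') y)]
  [IsContMDiffRiemannianBundle 𝓘(ℝ, E') ∞ E' (fun y : N ↦ TangentSpace 𝓘(ℝ, E') y)]
  {F : M → N}

/-- The differential of a Riemannian submersion preserves the inner products with horizontal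
vectors. -/
theorem IsRiemannianSubmersion.inner_mfderiv (hF : IsRiemannianSubmersion E E' F) {x : M}
    {v : TangentSpace 𝓘(ℝ, E) x} (hv : v ∈ horizontal E E' F x) (w : TangentSpace 𝓘(ℝ, E) x) :
    inner ℝ (mfderiv 𝓘(ℝ, E) 𝓘(ℝ, E') F x v) (mfderiv 𝓘(ℝ, E) 𝓘(ℝ, E') F x w) = inner ℝ v w := by
  have hor : ∀ u ∈ horizontal E E' F x,
      inner ℝ (mfderiv 𝓘(ℝ, E) 𝓘(ℝ, E') F x v) (mfderiv 𝓘(ℝ, E) 𝓘(ℝ, E') F x u) =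
        inner ℝ v u := fun u hu ↦ by
    rw [real_inner_eq_norm_add_mul_self_sub_norm_mul_self_sub_norm_mul_self_div_two,
      real_inner_eq_norm_add_mul_self_sub_norm_mul_self_sub_norm_mul_self_div_two, ← map_add,
      hF.norm_mfderiv x _ hv, hF.norm_mfderiv x _ hu,
      hF.norm_mfderiv x _ (Submodule.add_mem _ hv hu)]
  -- The horizontal case is polarization; the vertical part of `w` contributes nothing to either
  -- side.
  obtain ⟨a, ha, b, hb, rfl⟩ := (vertical E E' F x).exists_add_mem_mem_orthogonal w
  have ha0 : mfderiv 𝓘(ℝ, E) 𝓘(ℝ, E') F x a = 0 := ha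
  rw [map_add, ha0, zero_add, hor b hb, inner_add_right,
    Submodule.inner_left_of_mem_orthogonal ha hv, zero_add]

set_option synthInstance.maxHeartbeats 200000 in
set_option maxHeartbeats 1000000 in
/-- O'Neill's lemma: for horizontal fields `X`, `Y` and `V` vertical at the given point,
`2 g(∇_X Y, V) = g([X, Y], V)`. -/
theorem IsRiemannianSubmersion.koszul_eq (hF : IsRiemannianSubmersion E E' F) {x : M}
    {X Y V : Π x : M, TangentSpace 𝓘(ℝ, E) x}
    (hX : MDiffAt (T% X) x) (hY : MDiffAt (T% Y) x) (hV : MDiffAt (T% V) x)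
    (hXh : ∀ y, X y ∈ horizontal E E' F y) (hYh : ∀ y, Y y ∈ horizontal E E' F y)
    (hVx : V x ∈ vertical E E' F x) :
    koszul X Y V x = (1 / 2) * inner ℝ (VectorField.mlieBracket 𝓘(ℝ, E) X Y x) (V x) := by
  obtain ⟨p, e, he, rfl⟩ : ∃ p, ∃ e ∈ (extChartAt 𝓘(ℝ, E) p).target,
      (extChartAt 𝓘(ℝ, E) p).symm e = x :=
    ⟨x, _, mem_extChartAt_target x, extChartAt_to_inv x⟩
  set χ := extChartAt 𝓘(ℝ, E) p with hχ
  set x := χ.symm e with hx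
  set ψ := extChartAt 𝓘(ℝ, E') (F x) with hψ
  set f : E → N := F ∘ χ.symm with hf
  set G : E → E' := ψ ∘ f with hG
  -- `G` is `F` in charts and `K` the metric of `N` along `G`. As `K` factors through `G`, its
  -- derivative along `V` vanishes.
  set K : E → E' →L[ℝ] E' →L[ℝ] ℝ := fun y ↦ metricInChart (F x) (G y) with hK
  have hfs : ContMDiffAt 𝓘(ℝ, E) 𝓘(ℝ, E') ∞ f e :=
    (hF.contMDiff x).comp e (contMDiffAt_extChartAt_symm he)
  have hfe : f e ∈ ψ.source := mem_extChartAt_source (F x)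
  have hGs : ContDiffAt ℝ 2 G e := by
    have : ContMDiffAt 𝓘(ℝ, E) 𝓘(ℝ, E') ∞ G e :=
      contMDiffAt_extChartAt.comp e hfs
    exact this.contDiffAt.of_le ENat.LEInfty.out
  have hev : ∀ᶠ y in 𝓝 e, y ∈ χ.target ∧ f y ∈ ψ.source :=
    ((isOpen_extChartAt_target p).eventually_mem he).and
      (hfs.continuousAt.preimage_mem_nhds ((isOpen_extChartAt_source _).mem_nhds hfe))
  have hder : ∀ y ∈ χ.target, f y ∈ ψ.source → ∀ Z : Π x : M, TangentSpace 𝓘(ℝ, E) x,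
      (chartSymmDeriv (F x) (G y) (fderiv ℝ G y (chartField p Z y)) : E') =
        mfderiv 𝓘(ℝ, E) 𝓘(ℝ, E') F (χ.symm y) (Z (χ.symm y)) := by
    intro y hy hfy Z
    have h1 : MDifferentiableAt 𝓘(ℝ, E) 𝓘(ℝ, E') F (χ.symm y) :=
      (hF.contMDiff _).mdifferentiableAt (by simp)
    have h2 := (contMDiffAt_extChartAt_symm hy).mdifferentiableAt (by simp : (∞ : ℕ∞ω) ≠ 0)
    refine (chartSymmDeriv_fderiv_extChartAt_comp (h1.comp y h2) hfy _).trans ?_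
    refine (DFunLike.congr_fun (mfderiv_comp y h1 h2) (chartField p Z y)).trans ?_
    exact congrArg (mfderiv 𝓘(ℝ, E) 𝓘(ℝ, E') F (χ.symm y)) (chartSymmDeriv_chartField hy Z)
  -- One horizontal factor is enough for the metric of `M` to agree with the pullback of that of
  -- `N`; `V` need not be horizontal, nor vertical away from `x`.
  have hinner : ∀ y ∈ χ.target, f y ∈ ψ.source → ∀ A B : Π x : M, TangentSpace 𝓘(ℝ, E) x,
      (∀ q, A q ∈ horizontal E E' F q) →
      inner ℝ (A (χ.symm y)) (B (χ.symm y)) =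
        K y (fderiv ℝ G y (chartField p A y)) (fderiv ℝ G y (chartField p B y)) := by
    intro y hy hfy A B hA
    rw [← hF.inner_mfderiv (hA _), hK, metricInChart_apply]
    exact inner_eq_of_eq (ψ.left_inv hfy).symm (hder y hy hfy A).symm (hder y hy hfy B).symm
  have hmv : ∀ A B Z : Π x : M, TangentSpace 𝓘(ℝ, E) x, MDiffAt (T% A) x → MDiffAt (T% B) x →
      (∀ q, A q ∈ horizontal E E' F q) →
      mvfderiv 𝓘(ℝ, E) (fun q ↦ inner ℝ (A q) (B q)) x (Z x) =
        fderiv ℝ (fun y ↦ K y (fderiv ℝ G y (chartField p A y)) (fderiv ℝ G y (chartField p B y)))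
          e (chartField p Z e) := by
    intro A B Z hA hB hAh
    rw [← fderiv_comp_extChartAt_symm he (mdifferentiableAt_inner hA hB) Z]
    refine congrArg (fun L : E →L[ℝ] ℝ ↦ L (chartField p Z e)) (Filter.EventuallyEq.fderiv_eq ?_)
    filter_upwards [hev] with y hy using hinner y hy.1 hy.2 A B hAh
  have hGV : fderiv ℝ G e (chartField p V e) = 0 := by
    apply chartSymmDeriv_injective (ψ.map_source hfe)
    rw [map_zero]
    exact (hder e he hfe V).trans hVx
  have hKd : DifferentiableAt ℝ (metricInChart (F x)) (G e) :=
    ((contDiffOn_metricInChart (F x)).contDiffAt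
      ((isOpen_extChartAt_target _).mem_nhds (ψ.map_source hfe))).differentiableAt (by simp)
  have hKc : HasFDerivAt K (fderiv ℝ (metricInChart (F x)) (G e) ∘L fderiv ℝ G e) e :=
    HasFDerivAt.comp (g := metricInChart (F x))
      (g' := fderiv ℝ (metricInChart (F x)) (G e)) e hKd.hasFDerivAt (hGs.differentiableAt (by norm_num)).hasFDerivAt
  have hsymm : ∀ a b, K e a b = K e b a := metricInChart_comm (F x) (G e)
  have key := koszul_pullback_of_fderiv_eq_zero hGs hKc.differentiableAt
    hsymm (differentiableAt_chartField he hX)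
    (differentiableAt_chartField he hY) (differentiableAt_chartField he hV) hGV
    (by rw [hKc.fderiv, ContinuousLinearMap.comp_apply, hGV, map_zero])
  rw [← chartField_mlieBracket he hX hV, ← chartField_mlieBracket he hY hV,
    ← hmv Y V X hY hV hYh, ← hmv X V Y hX hV hXh, ← hmv X Y V hX hY hXh] at key
  have hbr : ∀ A B : Π x : M, TangentSpace 𝓘(ℝ, E) x, (∀ q, A q ∈ horizontal E E' F q) →
      K e (fderiv ℝ G e (chartField p B e)) (fderiv ℝ G e (chartField p A e)) =
        inner ℝ (B x) (A x) := fun A B hA ↦ by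
    rw [hsymm, ← hinner e he hfe A B hA]
    exact real_inner_comm _ _
  rw [hbr _ _ hXh, hbr _ _ hYh] at key
  rw [koszul]
  linear_combination (1 / 2) * key

end HorizontalKoszul

/-! ### O'Neill's tensor and the slant condition -/

section LeviCivitaZero

variable {E : Type*} [NormedAddCommGroup E] [NormedSpace ℝ E] [FiniteDimensional ℝ E]
  {M : Type*} [TopologicalSpace M] [ChartedSpace E M] [IsManifold 𝓘(ℝ, E) ∞ M]
  [RiemannianBundle (fun x : M ↦ TangentSpace 𝓘(ℝ, E) x)]

theorem leviCivita_zero_right (X : Π x : M, TangentSpace 𝓘(ℝ, E) x) : leviCivita X 0 = 0 := by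
  ext x
  simp only [leviCivita, koszul, Pi.zero_apply, inner_zero_left, inner_zero_right, map_zero,
    VectorField.mlieBracket_zero_left, VectorField.mlieBracket_zero_right]
  simp [mvfderiv, mfderiv_const]

end LeviCivitaZero

section SemiSlant

variable {E : Type*} [NormedAddCommGroup E] [NormedSpace ℝ E] [FiniteDimensional ℝ E]
  {E' : Type*} [NormedAddCommGroup E'] [NormedSpace ℝ E'] [FiniteDimensional ℝ E']
  {M : Type*} [TopologicalSpace M] [ChartedSpace E M] [IsManifold 𝓘(ℝ, E) ∞ M]
  [RiemannianBundle (fun x : M ↦ TangentSpace 𝓘(ℝ, E) x)]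
  {N : Type*} [TopologicalSpace N] [ChartedSpace E' N]

theorem horPart_eq_self {F : M → N} {X : Π x : M, TangentSpace 𝓘(ℝ, E) x}
    (hX : ∀ x, X x ∈ horizontal E E' F x) : horPart E E' F X = X :=
  funext fun x ↦ Submodule.starProjection_eq_self_iff.2 (hX x)

theorem vertPart_eq_zero {F : M → N} {X : Π x : M, TangentSpace 𝓘(ℝ, E) x}
    (hX : ∀ x, X x ∈ horizontal E E' F x) : vertPart E E' F X = 0 :=
  funext fun x ↦ (Submodule.starProjection_apply_eq_zero_iff _).2 (hX x)

theorem tensorA_of_horizontal {F : M → N} {X Y : Π x : M, TangentSpace 𝓘(ℝ, E) x}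
    (hX : ∀ x, X x ∈ horizontal E E' F x) (hY : ∀ x, Y x ∈ horizontal E E' F x) :
    tensorA E E' F X Y = vertPart E E' F (leviCivita X Y) := by
  rw [tensorA, horPart_eq_self hX, horPart_eq_self hY, vertPart_eq_zero hY, leviCivita_zero_right,
    horPart_eq_self (X := 0) (fun x ↦ Submodule.zero_mem _), zero_add]

variable [RiemannianBundle (fun y : N ↦ TangentSpace 𝓘(ℝ, E') y)]

/-- For horizontal fields, `𝒜_X Y` vanishes exactly where `[X, Y]` is horizontal. -/
theorem IsRiemannianSubmersion.tensorA_apply_eq_zero_iff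
    [IsContMDiffRiemannianBundle 𝓘(ℝ, E) ∞ E (fun x : M ↦ TangentSpace 𝓘(ℝ, E) x)]
    [IsManifold 𝓘(ℝ, E') ∞ N]
    [IsContMDiffRiemannianBundle 𝓘(ℝ, E') ∞ E' (fun y : N ↦ TangentSpace 𝓘(ℝ, E') y)]
    {F : M → N} (hF : IsRiemannianSubmersion E E' F) {X Y : Π x : M, TangentSpace 𝓘(ℝ, E) x}
    {x : M} (hX : MDiffAt (T% X) x) (hY : MDiffAt (T% Y) x)
    (hXh : ∀ x, X x ∈ horizontal E E' F x) (hYh : ∀ x, Y x ∈ horizontal E E' F x) :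
    tensorA E E' F X Y x = 0 ↔
      VectorField.mlieBracket 𝓘(ℝ, E) X Y x ∈ horizontal E E' F x := by
  rw [tensorA_of_horizontal hXh hYh, vertPart, Submodule.starProjection_apply_eq_zero_iff,
    horizontal, Submodule.mem_orthogonal', Submodule.mem_orthogonal']
  refine forall₂_congr fun v hv ↦ ?_
  -- Any differentiable extension of `v` serves, since `koszul_eq` asks for verticality at `x` only.
  have hZ : MDiffAt (T% (FiberBundle.extend E v)) x := FiberBundle.mdifferentiableAt_extend ..
  have hZv : FiberBundle.extend E v x = v := by simp
  have h := inner_leviCivita hX hY hZ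
  rw [hF.koszul_eq hX hY hZ hXh hYh (by rw [hZv]; exact hv), hZv] at h
  rw [h]
  simp

/-- In a v-semi-slant submersion with nonzero angle, a horizontal vector whose image under `J` is
horizontal lies in the complex distribution. -/
theorem IsVSemiSlantSubmersion.mem_of_map_mem_horizontal
    {J : Π x : M, TangentSpace 𝓘(ℝ, E) x →L[ℝ] TangentSpace 𝓘(ℝ, E) x} (hJ : IsAlmostHermitian J)
    {F : M → N} {D₁ : Π x : M, Submodule ℝ (TangentSpace 𝓘(ℝ, E) x)} {θ : ℝ}
    (hF : IsVSemiSlantSubmersion E E' J F D₁ θ) (hθ : θ ≠ 0) {x : M}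
    {v : TangentSpace 𝓘(ℝ, E) x} (hv : v ∈ horizontal E E' F x)
    (hJv : J x v ∈ horizontal E E' F x) : v ∈ D₁ x := by
  obtain ⟨a, ha, z, hz, rfl⟩ := (D₁ x).exists_add_mem_mem_orthogonal v
  have hJD : ∀ w ∈ D₁ x, J x w ∈ D₁ x := fun w hw ↦ by
    rw [← hF.map_complex x]; exact ⟨w, hw, rfl⟩
  have hzh : z ∈ horizontal E E' F x := by
    simpa using Submodule.sub_mem _ hv (hF.le_horizontal x ha)
  have hJzh : J x z ∈ horizontal E E' F x := by
    have := Submodule.sub_mem _ hJv (hF.le_horizontal x (hJD a ha))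
    simpa using this
  -- `J` is an isometry preserving `D₁`, so it preserves the orthogonal complement.
  have hJzo : J x z ∈ (D₁ x)ᗮ := by
    rw [Submodule.mem_orthogonal]
    intro u hu
    rw [← hF.map_complex x] at hu
    obtain ⟨w, hw, rfl⟩ := hu
    exact (hJ.inner_map_map x w z).trans (Submodule.inner_right_of_mem_orthogonal hw hz)
  by_cases hz0 : z = 0
  · rw [hz0, add_zero]; exact ha
  · exfalso
    have hJz0 : J x z ≠ 0 := fun h ↦ hz0 (by
      have := hJ.sq_eq_neg x z
      rw [h, map_zero] at this
      exact neg_eq_zero.1 this.symm)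
    have hang := hF.angle_eq x z ⟨hz, hzh⟩ hz0
    -- `J z` lies in `D₂` and is its own projection, so the angle is zero.
    rw [Submodule.starProjection_eq_self_iff.2
      (show J x z ∈ slantPart E E' F D₁ x from ⟨hJzo, hJzh⟩),
      InnerProductGeometry.angle_self hJz0] at hang
    exact hθ hang.symm

end SemiSlant
end VSemiSlant
end

/-! ### The theorem -/

theorem theorem3p5
    {E : Type*} [NormedAddCommGroup E] [NormedSpace ℝ E] [FiniteDimensional ℝ E]
    {E' : Type*} [NormedAddCommGroup E'] [NormedSpace ℝ E'] [FiniteDimensional ℝ E']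
    {M : Type*} [TopologicalSpace M] [T2Space M] [ChartedSpace E M] [IsManifold 𝓘(ℝ, E) ∞ M]
    [RiemannianBundle (fun x : M ↦ TangentSpace 𝓘(ℝ, E) x)]
    [IsContMDiffRiemannianBundle 𝓘(ℝ, E) ∞ E (fun x : M ↦ TangentSpace 𝓘(ℝ, E) x)]
    {N : Type*} [TopologicalSpace N] [T2Space N] [ChartedSpace E' N] [IsManifold 𝓘(ℝ, E') ∞ N]
    [RiemannianBundle (fun y : N ↦ TangentSpace 𝓘(ℝ, E') y)]
    [IsContMDiffRiemannianBundle 𝓘(ℝ, E') ∞ E' (fun y : N ↦ TangentSpace 𝓘(ℝ, E') y)]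
    (J : Π x : M, TangentSpace 𝓘(ℝ, E) x →L[ℝ] TangentSpace 𝓘(ℝ, E) x)
    (hJ : VSemiSlant.IsAlmostHermitian J)
    (F : M → N) (D₁ : Π x : M, Submodule ℝ (TangentSpace 𝓘(ℝ, E) x)) (θ : ℝ)
    (hF : VSemiSlant.IsVSemiSlantSubmersion E E' J F D₁ θ) (hθ : θ ≠ 0) :
    VSemiSlant.IsIntegrable D₁ ↔
      ∀ X Y : Π x : M, TangentSpace 𝓘(ℝ, E) x,
        VSemiSlant.IsSectionOf D₁ X → VSemiSlant.IsSectionOf D₁ Y →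
          VSemiSlant.tensorA E E' F X Y = 0 ∧
          VSemiSlant.opB E E' J F
            (VSemiSlant.leviCivita X Y - VSemiSlant.leviCivita Y X) = 0 := by
  rw [VSemiSlant.isIntegrable_iff_isInvolutive hF.isSmoothDistribution]
  have hbr : ∀ X Y : Π x : M, TangentSpace 𝓘(ℝ, E) x,
      VSemiSlant.IsSectionOf D₁ X → VSemiSlant.IsSectionOf D₁ Y →
      VSemiSlant.leviCivita X Y - VSemiSlant.leviCivita Y X =
        VectorField.mlieBracket 𝓘(ℝ, E) X Y := fun X Y hX hY ↦
    funext fun x ↦ VSemiSlant.leviCivita_sub (hX.mdifferentiableAt x) (hY.mdifferentiableAt x)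
  have hA : ∀ X Y : Π x : M, TangentSpace 𝓘(ℝ, E) x,
      VSemiSlant.IsSectionOf D₁ X → VSemiSlant.IsSectionOf D₁ Y → ∀ x,
      (VSemiSlant.tensorA E E' F X Y x = 0 ↔
        VectorField.mlieBracket 𝓘(ℝ, E) X Y x ∈ VSemiSlant.horizontal E E' F x) :=
    fun X Y hX hY x ↦ hF.tensorA_apply_eq_zero_iff (hX.mdifferentiableAt x)
      (hY.mdifferentiableAt x) (fun x ↦ hF.le_horizontal x (hX.2 x))
      (fun x ↦ hF.le_horizontal x (hY.2 x))
  -- The equivalence already holds for each fixed pair of sections.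
  refine forall₂_congr fun X Y ↦ forall₂_congr fun hX hY ↦ ?_
  rw [hbr X Y hX hY]
  constructor
  · intro h
    have hh : ∀ x, VectorField.mlieBracket 𝓘(ℝ, E) X Y x ∈ VSemiSlant.horizontal E E' F x :=
      fun x ↦ hF.le_horizontal x (h x)
    refine ⟨funext fun x ↦ (hA X Y hX hY x).2 (hh x), ?_⟩
    rw [VSemiSlant.opB, VSemiSlant.horPart_eq_self hh]
    refine VSemiSlant.vertPart_eq_zero fun x ↦ hF.le_horizontal x ?_
    rw [← hF.map_complex x]
    exact ⟨_, h x, rfl⟩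
  · rintro ⟨h1, h2⟩ x
    have hh : ∀ x, VectorField.mlieBracket 𝓘(ℝ, E) X Y x ∈ VSemiSlant.horizontal E E' F x :=
      fun x ↦ (hA X Y hX hY x).1 (congrFun h1 x)
    -- Once the bracket is known to be horizontal, `B[X, Y] = 0` says that `J[X, Y]` is horizontal
    -- too.
    rw [VSemiSlant.opB, VSemiSlant.horPart_eq_self hh] at h2
    exact hF.mem_of_map_mem_horizontal hJ hθ (hh x)
      ((Submodule.starProjection_apply_eq_zero_iff _).1 (congrFun h2 x))
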